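/- Let $\mathbb S=\mathbb R/\mathbb Z$ and $\mathbb K\in\{\mathbb R,\mathbb C\}$. For $s\ge 0$ let $H^s(\mathbb S;\mathbb K)$ be the space of (classes of) functions $u\in L^2(\mathbb S;\mathbb K)$ with $$\|u\|_{H^s}:=\Big(\sum_{k\in\mathbb Z}(1+k^2)^s|\hat u_k|^2\Big)^{1/2}<\infty,\qquad \hat u_k=\int_{\mathbb S}u(x)e^{-2\pi i kx}\,dx .$$ For $q>3/2$ let $\mathcal D^q$ be the set of orientation preserving $C^1$ diffeomorphisms $\varphi$ of $\mathbb S$ such that both $\varphi$ and $\varphi^{-1}$ are of class $H^q$, i.e. each has a lift $x\mapsto x+g(x)$ to $\mathbb R$ whose ($1$-periodic) displacement $g$ belongs to $H^q(\mathbb S;\mathbb R)$. Give $\mathcal D^q$ its Hilbert manifold topology, i.e. the quotient topology under $g\mapsto(\mathrm{id}+g \bmod 1)$ of the $H^q$ topology on the displacements $g$ of the elements of $\mathcal D^q$. Let $\rho,q\in\mathbb R$ with $3/2<\rho\le q$. Then for every $\varphi\in\mathcal D^q$ the composition $R_\varphi u:=u\circ\varphi$ is well defined and gives a bounded linear operator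 $R_\varphi\in\mathcal L(H^\rho(\mathbb S;\mathbb K))$; the mapping $$(\varphi,u)\mapsto u\circ\varphi,\qquad \mathcal D^q\times H^\rho(\mathbb S;\mathbb K)\to H^\rho(\mathbb S;\mathbb K)$$ is continuous; and the mappings $$\varphi\mapsto R_\varphi\quad\text{and}\quad \varphi\mapsto R_{\varphi^{-1}},\qquad \mathcal D^q\to\mathcal L(H^\rho(\mathbb S;\mathbb K)),$$ are locally bounded: every $\varphi_0\in\mathcal D^q$ has a neighbourhood on which the operator norms are bounded. -/

import Mathlib

open MeasureTheory Topology Filter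

noncomputable section

namespace CircleSobolev

/-- The space `L²(𝕊; 𝕜)` on the circle `𝕊 = ℝ/ℤ` with its Haar (Lebesgue) probability measure,
where `𝕜` is `ℝ` or `ℂ`. -/
abbrev L2 (𝕜 : Type*) [RCLike 𝕜] : Type _ :=
  Lp 𝕜 2 (AddCircle.haarAddCircle : Measure UnitAddCircle)

/-- The Fourier coefficient `û(k) = ∫ u(x) exp(-2πikx) dx`, a complex number also when `u` is
real-valued (`RCLike.map 𝕜 ℂ` is the inclusion of `𝕜` into `ℂ`). -/
def coeff {𝕜 : Type*} [RCLike 𝕜] (u : L2 𝕜) (k : ℤ) : ℂ :=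
  fourierCoeff (fun x : UnitAddCircle => RCLike.map 𝕜 ℂ (u x)) k

section coeff

variable {𝕜 : Type*} [RCLike 𝕜]

theorem map_mul' (a b : 𝕜) : RCLike.map 𝕜 ℂ (a * b) = RCLike.map 𝕜 ℂ a * RCLike.map 𝕜 ℂ b := by
  rcases RCLike.I_eq_zero_or_im_I_eq_one (K := 𝕜) with h | h
  · have him : ∀ z : 𝕜, RCLike.im z = 0 := fun z => by
      have hz := RCLike.im_eq_zero h z
      exact hz
    simp [RCLike.map_apply, him]
  · apply Complex.ext <;> simp [RCLike.map_apply]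

theorem norm_map' (a : 𝕜) : ‖RCLike.map 𝕜 ℂ a‖ = ‖a‖ := by
  have h1 : ‖RCLike.map 𝕜 ℂ a‖ ^ 2 = ‖a‖ ^ 2 := by
    rw [← RCLike.normSq_eq_def', ← RCLike.normSq_eq_def', RCLike.normSq_apply,
      RCLike.normSq_apply]
    simp [RCLike.map_apply]
  exact (sq_eq_sq₀ (norm_nonneg _) (norm_nonneg _)).1 h1

theorem coeff_eq (u : L2 𝕜) :
    coeff u = fourierCoeff (((RCLike.map 𝕜 ℂ).compLp u : Lp ℂ 2 AddCircle.haarAddCircle) :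
      UnitAddCircle → ℂ) := by
  refine fourierCoeff_congr_ae ?_
  filter_upwards [(RCLike.map 𝕜 ℂ).coeFn_compLp u] with x hx
  exact hx.symm

theorem coeff_add (u v : L2 𝕜) : coeff (u + v) = coeff u + coeff v := by
  rw [coeff_eq, coeff_eq, coeff_eq, ← fourierCoeff.add]
  · refine fourierCoeff_congr_ae ?_
    filter_upwards [(RCLike.map 𝕜 ℂ).coeFn_compLp (u + v), (RCLike.map 𝕜 ℂ).coeFn_compLp u,
      (RCLike.map 𝕜 ℂ).coeFn_compLp v, Lp.coeFn_add u v] with x h1 h2 h3 h4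
    rw [Pi.add_apply, h1, h2, h3, h4, Pi.add_apply, map_add]
  · exact (Lp.memLp _).integrable (by norm_num)
  · exact (Lp.memLp _).integrable (by norm_num)

theorem coeff_smul (c : 𝕜) (u : L2 𝕜) (k : ℤ) :
    coeff (c • u) k = RCLike.map 𝕜 ℂ c * coeff u k := by
  unfold coeff
  rw [← fourierCoeff.const_mul]
  refine congrFun (fourierCoeff_congr_ae ?_) k
  filter_upwards [Lp.coeFn_smul c u] with x hx
  rw [hx, Pi.smul_apply, smul_eq_mul, map_mul']

theorem coeff_zero : coeff (0 : L2 𝕜) = 0 := by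
  have h := coeff_add (0 : L2 𝕜) 0
  simpa using h

theorem eq_zero_of_coeff {u : L2 𝕜} (h : coeff u = 0) : u = 0 := by
  have h1 : ((RCLike.map 𝕜 ℂ).compLp u : Lp ℂ 2 AddCircle.haarAddCircle) = 0 := by
    apply (fourierBasis (T := 1)).repr.injective
    ext k
    rw [fourierBasis_repr, ← coeff_eq, h]
    simp
  rw [Lp.eq_zero_iff_ae_eq_zero]
  have h2 := (RCLike.map 𝕜 ℂ).coeFn_compLp u
  rw [h1] at h2
  filter_upwards [h2, Lp.coeFn_zero ℂ 2 (AddCircle.haarAddCircle : Measure UnitAddCircle)]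
    with x hx hx0
  rw [hx0] at hx
  have : ‖u x‖ = 0 := by rw [← norm_map', ← hx]; simp
  simpa using this

end coeff

/-- The sequence `k ↦ (1 + k²)^{s/2} û(k)`. -/
def weighted {𝕜 : Type*} [RCLike 𝕜] (s : ℝ) (u : L2 𝕜) (k : ℤ) : ℂ :=
  (((1 + (k : ℝ) ^ 2) ^ (s / 2) : ℝ) : ℂ) * coeff u k

theorem norm_weighted_sq {𝕜 : Type*} [RCLike 𝕜] (s : ℝ) (u : L2 𝕜) (k : ℤ) :
    ‖weighted s u k‖ ^ 2 = (1 + (k : ℝ) ^ 2) ^ s * ‖coeff u k‖ ^ 2 := by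
  have h : (0 : ℝ) < 1 + (k : ℝ) ^ 2 := by positivity
  rw [weighted, norm_mul, mul_pow, Complex.norm_real, Real.norm_of_nonneg (by positivity),
    ← Real.rpow_natCast, ← Real.rpow_mul h.le]
  norm_num

theorem memlp_weighted_iff {𝕜 : Type*} [RCLike 𝕜] (s : ℝ) (u : L2 𝕜) :
    Memℓp (weighted s u) 2 ↔
      Summable fun k : ℤ => (1 + (k : ℝ) ^ 2) ^ s * ‖coeff u k‖ ^ 2 := by
  rw [memℓp_gen_iff (by norm_num)]
  refine summable_congr fun k => ?_
  rw [← norm_weighted_sq]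
  norm_num

theorem weighted_add {𝕜 : Type*} [RCLike 𝕜] (s : ℝ) (u v : L2 𝕜) :
    weighted s (u + v) = weighted s u + weighted s v := by
  ext k
  simp [weighted, coeff_add, mul_add]

theorem weighted_smul {𝕜 : Type*} [RCLike 𝕜] (s : ℝ) (c : 𝕜) (u : L2 𝕜) :
    weighted s (c • u) = RCLike.map 𝕜 ℂ c • weighted s u := by
  ext k
  simp only [weighted, coeff_smul, Pi.smul_apply, smul_eq_mul]
  ring

/-- The functions `u ∈ L²(𝕊; 𝕜)` with `∑ₖ (1 + k²)^s |û(k)|² < ∞`. -/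
def submodule (𝕜 : Type*) [RCLike 𝕜] (s : ℝ) : Submodule 𝕜 (L2 𝕜) where
  carrier := {u | Summable fun k : ℤ => (1 + (k : ℝ) ^ 2) ^ s * ‖coeff u k‖ ^ 2}
  zero_mem' := by simp [coeff_zero, summable_zero]
  add_mem' {u v} hu hv := by
    rw [Set.mem_ofPred_eq, ← memlp_weighted_iff] at *
    rw [weighted_add]
    exact hu.add hv
  smul_mem' c u hu := by
    rw [Set.mem_ofPred_eq, ← memlp_weighted_iff] at *
    rw [weighted_smul]
    exact hu.const_smul _

/-- The Sobolev space `H^s(𝕊; 𝕜)`, for `s ≥ 0`. -/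
def Space (𝕜 : Type*) [RCLike 𝕜] (s : ℝ) : Type _ := submodule 𝕜 s

namespace Space

variable {𝕜 : Type*} [RCLike 𝕜] {s : ℝ}

instance : AddCommGroup (Space 𝕜 s) := inferInstanceAs (AddCommGroup (submodule 𝕜 s))

instance : Module 𝕜 (Space 𝕜 s) := inferInstanceAs (Module 𝕜 (submodule 𝕜 s))

/-- The underlying `L²` class. -/
def toL2 (u : Space 𝕜 s) : L2 𝕜 := u.1

/-- The weighted Fourier coefficients as an element of `ℓ²(ℤ)`. -/
def toLp (s : ℝ) : Space 𝕜 s →+ lp (fun _ : ℤ => ℂ) 2 where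
  toFun u := ⟨weighted s u.toL2, (memlp_weighted_iff s _).2 u.2⟩
  map_zero' := by
    ext k
    change weighted s (0 : L2 𝕜) k = 0
    simp [weighted, coeff_zero]
  map_add' u v := by
    ext k
    exact congrFun (weighted_add s u.toL2 v.toL2) k

theorem toLp_injective : Function.Injective (toLp (𝕜 := 𝕜) s) := by
  refine (injective_iff_map_eq_zero _).2 fun u hu => ?_
  refine Subtype.ext (eq_zero_of_coeff ?_)
  ext k
  have h1 : weighted s u.toL2 k = 0 := congrFun (congrArg Subtype.val hu) k
  have h : (0 : ℝ) < (1 + (k : ℝ) ^ 2) ^ (s / 2) := by positivity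
  rw [weighted, mul_eq_zero, Complex.ofReal_eq_zero] at h1
  exact h1.resolve_left h.ne'

/-- The norm of `H^s(𝕊; 𝕜)`: see `norm_eq` for its formula. -/
instance : NormedAddCommGroup (Space 𝕜 s) :=
  NormedAddCommGroup.induced (Space 𝕜 s) (lp (fun _ : ℤ => ℂ) 2) (toLp s) toLp_injective

/-- `‖u‖_{H^s} = (∑ₖ (1 + k²)^s |û(k)|²)^{1/2}`. -/
theorem norm_eq (u : Space 𝕜 s) :
    ‖u‖ = Real.sqrt (∑' k : ℤ, (1 + (k : ℝ) ^ 2) ^ s * ‖coeff u.toL2 k‖ ^ 2) := by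
  change ‖toLp s u‖ = _
  rw [lp.norm_eq_tsum_rpow (by norm_num), Real.sqrt_eq_rpow]
  congr 1
  · refine tsum_congr fun k => ?_
    rw [← norm_weighted_sq]
    norm_num [toLp]

instance : NormedSpace 𝕜 (Space 𝕜 s) where
  norm_smul_le c u := by
    change ‖toLp s (c • u)‖ ≤ ‖c‖ * ‖toLp s u‖
    have h : toLp s (c • u) = RCLike.map 𝕜 ℂ c • toLp s u := by
      ext k
      exact congrFun (weighted_smul s c u.toL2) k
    rw [h, norm_smul, norm_map']

/-- Elements of `H^s` as functions on the circle (defined up to null sets). -/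
instance : CoeFun (Space 𝕜 s) fun _ => UnitAddCircle → 𝕜 := ⟨fun u => u.toL2⟩

end Space

/-- The circle map `φ` is an orientation preserving `C¹` map of degree one with displacement
`φ - id` (lifted to a real-valued function) of Sobolev class `H^q`, represented by `g`: there is
a continuous function `d : 𝕊 → ℝ` in the class of `g` such that `φ(x) = x + d(x)` modulo `1`, and
the lift `x ↦ x + d(x)` of `φ` to `ℝ` is strictly increasing and `C¹`. -/
def IsDisplacement {q : ℝ} (φ : UnitAddCircle → UnitAddCircle) (g : Space ℝ q) : Prop :=
  ∃ d : C(UnitAddCircle, ℝ),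
    (∀ x : UnitAddCircle, φ x = x + ((d x : ℝ) : UnitAddCircle)) ∧
    StrictMono (fun x : ℝ => x + d (x : UnitAddCircle)) ∧
    ContDiff ℝ 1 (fun x : ℝ => x + d (x : UnitAddCircle)) ∧
    (g : UnitAddCircle → ℝ) =ᵐ[AddCircle.haarAddCircle] d

/-- The set `D^q` (for `q > 3/2`) of orientation preserving diffeomorphisms `φ` of the circle such
that both `φ` and `φ⁻¹` are of Sobolev class `H^q`. -/
structure Diffeo (q : ℝ) where
  /-- the underlying homeomorphism -/
  toHomeomorph : UnitAddCircle ≃ₜ UnitAddCircle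
  exists_displacement : ∃ g : Space ℝ q, IsDisplacement toHomeomorph g
  exists_displacement_symm : ∃ g : Space ℝ q, IsDisplacement toHomeomorph.symm g

namespace Diffeo

variable {q : ℝ}

instance : CoeFun (Diffeo q) fun _ => UnitAddCircle → UnitAddCircle := ⟨fun φ => φ.toHomeomorph⟩

/-- The inverse diffeomorphism. -/
instance : Inv (Diffeo q) where
  inv φ := ⟨φ.toHomeomorph.symm, φ.exists_displacement_symm, φ.exists_displacement⟩

/-- A diffeomorphism in `D^q` together with a choice of its displacement `g ∈ H^q(𝕊; ℝ)`, that is,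
with a choice of a lift `x ↦ x + g(x)` to `ℝ`; two choices differ by an integer constant. -/
def Lift (q : ℝ) : Type := {p : Diffeo q × Space ℝ q // IsDisplacement p.1 p.2}

/-- Lifts carry the `H^q` topology of their displacements. -/
instance : TopologicalSpace (Lift q) :=
  TopologicalSpace.induced (fun p : Lift q => p.1.2) inferInstance

/-- The topology of `D^q`: the quotient topology of `{lifts} → D^q` (lifts modulo integer
translations). This is the manifold topology, whose charts near `φ` are the local inverses of
`g ↦ (id + g mod 1)`, with `g` in an open subset of the Hilbert space `H^q(𝕊; ℝ)`. -/
instance : TopologicalSpace (Diffeo q) :=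
  TopologicalSpace.coinduced (fun p : Lift q => p.1.1) inferInstance

end Diffeo

/-- A map into a normed space is locally bounded if every point has a neighbourhood on which it is
bounded in norm. -/
def LocallyBounded {X E : Type*} [TopologicalSpace X] [Norm E] (F : X → E) : Prop :=
  ∀ x₀ : X, ∃ U ∈ 𝓝 x₀, ∃ C : ℝ, ∀ x ∈ U, ‖F x‖ ≤ C

end CircleSobolev

end

open scoped ENNReal

namespace CircleSobolev

/-! Everything is measured by the squared norm `energy s` of a Fourier coefficient sequence, valued
in `[0, ∞]` so that no finiteness has to be known in advance. The threshold `3/2` enters through `r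
= q - 1 > 1/2`: for such `r` the space `H^r` embeds in `C⁰` and multiplies every `H^s` with `0 ≤ s ≤
r` into itself (`energy_mul_le`), and the derivative of `φ` lies in `H^r`.

Boundedness of `R_φ` (`exists_compBound`). On `H⁰` it is a change of variables, on `H¹` it follows
from the chain rule, and on the exponents in between from interpolation by the K-functional. Beyond
`1` one climbs in unit steps: `(f ∘ φ)' = (f' ∘ φ) φ'` bounds composition on `H^{s+1}` by
composition on `H^s` and multiplication by `φ'`, as long as `s ≤ q - 1`. The constant depends only
on upper and lower bounds of `φ'` and on a multiplier bound, and these are uniform near a given `φ₀`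
(`IsLiftData.exists_local_bounds`). The inverse is treated in the same way, with `1/φ'` in place of
`φ'`. This gives both local boundedness statements.

Joint continuity. By the local bounds it suffices that `φ ↦ u ∘ φ` is continuous for fixed `u`, and
by density of trigonometric polynomials that it is so for `u = e_n`. There the same climb, applied
to `e_n ∘ φ - e_n ∘ φ₀`, gives a local Lipschitz bound in the displacement
(`IsLiftData.exists_energy_fourier_comp_sub_le`). Finally `setOf_exists_displacement_mem_nhds`
translates closeness of displacements into neighbourhoods for the quotient topology. -/

/-! ### Weighted energies of Fourier coefficient sequences -/

/-- The weight `1 + k²`. -/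
def wt (k : ℤ) : ℝ≥0∞ := ENNReal.ofReal (1 + (k : ℝ) ^ 2)

theorem one_le_wt (k : ℤ) : 1 ≤ wt k := by
  rw [wt, ← ENNReal.ofReal_one]
  exact ENNReal.ofReal_le_ofReal (by nlinarith [sq_nonneg (k : ℝ)])

theorem wt_ne_zero (k : ℤ) : wt k ≠ 0 := (zero_lt_one.trans_le (one_le_wt k)).ne'

theorem wt_ne_top (k : ℤ) : wt k ≠ ⊤ := ENNReal.ofReal_ne_top

theorem wt_rpow_ne_top (k : ℤ) (s : ℝ) : wt k ^ s ≠ ⊤ :=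
  ENNReal.rpow_ne_top_of_ne_zero (wt_ne_zero k) (wt_ne_top k)

theorem wt_rpow_eq_ofReal (k : ℤ) (s : ℝ) :
    wt k ^ s = ENNReal.ofReal ((1 + (k : ℝ) ^ 2) ^ s) :=
  ENNReal.ofReal_rpow_of_pos (by positivity)

theorem wt_rpow_add (k : ℤ) (s t : ℝ) : wt k ^ (s + t) = wt k ^ s * wt k ^ t :=
  ENNReal.rpow_add _ _ (wt_ne_zero k) (wt_ne_top k)

/-- From `k = m + (k - m)` one gets `k² ≤ 2m² + 2(k - m)²`. This lets the weight of a convolution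
fall on whichever factor has the higher frequency. -/
theorem wt_le_four_mul_max (k m : ℤ) : wt k ≤ 4 * max (wt m) (wt (k - m)) := by
  have h4 : (4 : ℝ≥0∞) = ENNReal.ofReal 4 := by norm_num
  rw [wt, wt, wt, ← ENNReal.ofReal_max, h4, ← ENNReal.ofReal_mul (by norm_num)]
  apply ENNReal.ofReal_le_ofReal
  push_cast
  rcases le_total (1 + (m : ℝ) ^ 2) (1 + ((k : ℝ) - m) ^ 2) with h | h
  · rw [max_eq_right h]; nlinarith [sq_nonneg ((k : ℝ) - 2 * m)]
  · rw [max_eq_left h]; nlinarith [sq_nonneg ((k : ℝ) - 2 * m)]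

/-- The squared `H^s` norm of a sequence of Fourier coefficients. -/
noncomputable def energy (s : ℝ) (a : ℤ → ℂ) : ℝ≥0∞ := ∑' k, wt k ^ s * ‖a k‖ₑ ^ 2

theorem energy_zero_left (a : ℤ → ℂ) : energy 0 a = ∑' k, ‖a k‖ₑ ^ 2 := by simp [energy]

theorem energy_mono {s t : ℝ} (h : s ≤ t) (a : ℤ → ℂ) : energy s a ≤ energy t a :=
  ENNReal.tsum_le_tsum fun k => by
    gcongr
    exact one_le_wt k

theorem energy_mono_seq (s : ℝ) {a b : ℤ → ℂ} (h : ∀ k, ‖a k‖ₑ ≤ ‖b k‖ₑ) :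
    energy s a ≤ energy s b :=
  ENNReal.tsum_le_tsum fun k => by gcongr; exact h k

theorem sq_add_le (x y : ℝ≥0∞) : (x + y) ^ 2 ≤ 2 * (x ^ 2 + y ^ 2) := by
  have h := ENNReal.rpow_add_le_mul_rpow_add_rpow x y (p := 2) (by norm_num)
  norm_num at h
  exact h

theorem energy_add_le (s : ℝ) (a b : ℤ → ℂ) :
    energy s (a + b) ≤ 2 * (energy s a + energy s b) := by
  rw [energy, energy, energy, ← ENNReal.tsum_add, ← ENNReal.tsum_mul_left]
  refine ENNReal.tsum_le_tsum fun k => ?_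
  calc wt k ^ s * ‖(a + b) k‖ₑ ^ 2 ≤ wt k ^ s * (‖a k‖ₑ + ‖b k‖ₑ) ^ 2 := by
        gcongr; exact enorm_add_le _ _
    _ ≤ wt k ^ s * (2 * (‖a k‖ₑ ^ 2 + ‖b k‖ₑ ^ 2)) := by gcongr; exact sq_add_le _ _
    _ = _ := by ring

theorem energy_const_mul (s : ℝ) (c : ℂ) (a : ℤ → ℂ) :
    energy s (fun k => c * a k) = ‖c‖ₑ ^ 2 * energy s a := by
  rw [energy, energy, ← ENNReal.tsum_mul_left]
  refine tsum_congr fun k => ?_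
  rw [enorm_mul]; ring

theorem energy_neg (s : ℝ) (a : ℤ → ℂ) : energy s (-a) = energy s a := by
  simp [energy]

theorem sq_enorm_le_energy {s : ℝ} (hs : 0 ≤ s) (a : ℤ → ℂ) (k : ℤ) :
    ‖a k‖ₑ ^ 2 ≤ energy s a := by
  refine le_trans ?_ (energy_mono hs a)
  rw [energy_zero_left]
  exact ENNReal.le_tsum k

/-- Lower semicontinuity of the energy under pointwise convergence. -/
theorem energy_le_of_tendsto {ι : Type*} {l : Filter ι} [l.NeBot] (s : ℝ) {a : ι → ℤ → ℂ}
    {b : ℤ → ℂ} {C : ℝ≥0∞} (hab : ∀ k, Tendsto (fun i => a i k) l (𝓝 (b k)))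
    (hC : ∀ i, energy s (a i) ≤ C) : energy s b ≤ C := by
  rw [energy, ENNReal.tsum_eq_iSup_sum]
  refine iSup_le fun F => ?_
  have h : Tendsto (fun i => ∑ k ∈ F, wt k ^ s * ‖a i k‖ₑ ^ 2) l
      (𝓝 (∑ k ∈ F, wt k ^ s * ‖b k‖ₑ ^ 2)) := by
    refine tendsto_finsetSum _ fun k _ => ?_
    refine ENNReal.Tendsto.const_mul ?_ (Or.inr (wt_rpow_ne_top k s))
    exact ENNReal.Tendsto.pow ((continuous_enorm.tendsto _).comp (hab k))
  exact le_of_tendsto h (Eventually.of_forall fun i =>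
    (ENNReal.sum_le_tsum F).trans (hC i))

/-! ### Convolution and product estimates on `ℤ` -/

/-- Cauchy-Schwarz for sums in `[0, ∞]`. -/
theorem sq_tsum_mul_le {ι : Type*} (x y : ι → ℝ≥0∞) :
    (∑' i, x i * y i) ^ 2 ≤ (∑' i, x i ^ 2) * ∑' i, y i ^ 2 := by
  let _ : MeasurableSpace ι := ⊤
  have h := ENNReal.lintegral_mul_le_Lp_mul_Lq (μ := (Measure.count : Measure ι))
    (Real.HolderConjugate.two_two) (f := x) (g := y) (measurable_from_top.aemeasurable)
    (measurable_from_top.aemeasurable)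
  simp only [lintegral_count, Pi.mul_apply] at h
  have h2 := pow_le_pow_left' h 2
  rw [mul_pow, ← ENNReal.rpow_natCast (_ ^ _), ← ENNReal.rpow_natCast (_ ^ _),
    ← ENNReal.rpow_mul, ← ENNReal.rpow_mul] at h2
  norm_num at h2
  exact h2

/-- Young's inequality `ℓ¹ * ℓ² ⊆ ℓ²`. -/
theorem tsum_sq_conv_le (x y : ℤ → ℝ≥0∞) :
    ∑' k, (∑' m, x m * y (k - m)) ^ 2 ≤ (∑' m, x m) ^ 2 * ∑' m, y m ^ 2 := by
  -- Cauchy-Schwarz after splitting `x = x^{1/2} · x^{1/2}`; summing over `k` then only translates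
  -- `y`.
  have h : ∀ k, (∑' m, x m * y (k - m)) ^ 2 ≤ (∑' m, x m) * ∑' m, x m * y (k - m) ^ 2 := by
    intro k
    have hx : ∀ m, (x m ^ (1 / 2 : ℝ)) ^ 2 = x m := fun m => by
      rw [← ENNReal.rpow_natCast, ← ENNReal.rpow_mul]; norm_num
    have := sq_tsum_mul_le (fun m => x m ^ (1 / 2 : ℝ)) fun m => x m ^ (1 / 2 : ℝ) * y (k - m)
    simp only [mul_pow, ← mul_assoc, ← sq, hx] at this
    exact this
  refine (ENNReal.tsum_le_tsum h).trans ?_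
  rw [ENNReal.tsum_mul_left, ENNReal.tsum_comm, sq, mul_assoc]
  gcongr
  rw [← ENNReal.tsum_mul_right]
  refine ENNReal.tsum_le_tsum fun m => ?_
  rw [ENNReal.tsum_mul_left]
  exact mul_le_mul_right ((Equiv.subRight m).tsum_eq fun k => y k ^ 2).le _

/-- The constant of the embedding `H^r ⊆ ℓ¹` on the Fourier side. -/
noncomputable def embConst (r : ℝ) : ℝ≥0∞ := ∑' k, wt k ^ (-r)

theorem embConst_ne_top {r : ℝ} (hr : 1 / 2 < r) : embConst r ≠ ⊤ := by
  have hs : Summable fun k : ℤ => (1 + (k : ℝ) ^ 2) ^ (-r) := by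
    have h1 : Summable fun n : ℕ => (1 + (n : ℝ) ^ 2) ^ (-r) := by
      -- The shift removes `n = 0`, where the comparison with `n^{-2r}` would fail.
      rw [← summable_nat_add_iff 1]
      have h2 : Summable fun n : ℕ => ((n + 1 : ℕ) : ℝ) ^ (-(2 * r)) :=
        (summable_nat_add_iff 1).2 (Real.summable_nat_rpow.2 (by linarith))
      refine Summable.of_nonneg_of_le (fun n => by positivity) (fun n => ?_) h2
      rw [show -(2 * r) = 2 * (-r) by ring, Real.rpow_mul (by positivity)]
      refine Real.rpow_le_rpow_of_nonpos (by positivity) ?_ (by linarith)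
      rw [Real.rpow_two]
      linarith
    exact Summable.of_nat_of_neg h1 (by simpa using h1)
  have : embConst r = ENNReal.ofReal (∑' k : ℤ, (1 + (k : ℝ) ^ 2) ^ (-r)) := by
    rw [ENNReal.ofReal_tsum_of_nonneg (fun k => by positivity) hs]
    exact tsum_congr fun k => wt_rpow_eq_ofReal k _
  rw [this]
  exact ENNReal.ofReal_ne_top

theorem wt_rpow_half_sq (k : ℤ) (s : ℝ) : (wt k ^ (s / 2)) ^ 2 = wt k ^ s := by
  rw [← ENNReal.rpow_natCast, ← ENNReal.rpow_mul]; norm_num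

/-- Cauchy-Schwarz with the weight split as `(s - r)/2 = -r/2 + s/2`. For `s = r` it is the
embedding `H^r ⊆ ℓ¹`; for `s < r` the negative weight is what the product estimate leaves on the
rougher factor. -/
theorem sq_tsum_rpow_mul_enorm_le (s r : ℝ) (a : ℤ → ℂ) :
    (∑' k, wt k ^ ((s - r) / 2) * ‖a k‖ₑ) ^ 2 ≤ embConst r * energy s a := by
  have h := sq_tsum_mul_le (fun k => wt k ^ (-r / 2)) fun k => wt k ^ (s / 2) * ‖a k‖ₑ
  simp only [mul_pow, wt_rpow_half_sq, ← mul_assoc, ← wt_rpow_add] at h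
  rw [embConst, energy]
  convert h using 6
  ring

theorem sq_tsum_enorm_le (r : ℝ) (a : ℤ → ℂ) :
    (∑' k, ‖a k‖ₑ) ^ 2 ≤ embConst r * energy r a := by
  simpa using sq_tsum_rpow_mul_enorm_le r r a

/-- The constant in the multiplication theorem `H^s · H^r ⊆ H^s`. -/
noncomputable def mulConst (s r : ℝ) : ℝ≥0∞ := 4 ^ s * 4 * embConst r

theorem mulConst_ne_top {s r : ℝ} (hr : 1 / 2 < r) : mulConst s r ≠ ⊤ :=
  ENNReal.mul_ne_top (ENNReal.mul_ne_top
    (ENNReal.rpow_ne_top_of_ne_zero (by norm_num) (by norm_num)) (by norm_num))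
    (embConst_ne_top hr)

/-- The weight `wt k ^ (s/2)` is moved onto the factor of higher frequency. If that is `a`, Young's
inequality is used with `b ∈ ℓ¹`. If it is `b`, the surplus `wt (k - m) ^ ((s - r)/2)` has a
nonpositive exponent, so it can be traded for the same power of the smaller weight `wt m`; Young's
inequality then applies with weighted `a ∈ ℓ¹`. -/
theorem energy_conv_le {s r : ℝ} (hs : 0 ≤ s) (hsr : s ≤ r) {a b c : ℤ → ℂ}
    (hc : ∀ k, ‖c k‖ₑ ≤ ∑' m, ‖a m‖ₑ * ‖b (k - m)‖ₑ) :
    energy s c ≤ mulConst s r * energy s a * energy r b := by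
  set A : ℤ → ℝ≥0∞ := fun m => wt m ^ (s / 2) * ‖a m‖ₑ with hA
  set A' : ℤ → ℝ≥0∞ := fun m => wt m ^ ((s - r) / 2) * ‖a m‖ₑ with hA'
  set B : ℤ → ℝ≥0∞ := fun m => wt m ^ (r / 2) * ‖b m‖ₑ with hB
  set B' : ℤ → ℝ≥0∞ := fun m => ‖b m‖ₑ with hB'
  have hpt : ∀ k m, wt k ^ (s / 2) * (‖a m‖ₑ * ‖b (k - m)‖ₑ) ≤
      4 ^ (s / 2) * (A m * B' (k - m) + A' m * B (k - m)) := by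
    intro k m
    have h1 : wt k ^ (s / 2) ≤ 4 ^ (s / 2) * max (wt m) (wt (k - m)) ^ (s / 2) := by
      rw [← ENNReal.mul_rpow_of_nonneg _ _ (by linarith)]
      exact ENNReal.rpow_le_rpow (wt_le_four_mul_max k m) (by linarith)
    refine (mul_le_mul_left h1 _).trans ?_
    rw [mul_assoc]
    gcongr
    rcases le_total (wt (k - m)) (wt m) with h | h
    · rw [max_eq_left h]
      refine le_trans (le_of_eq ?_) le_self_add
      simp only [hA, hB']; ring
    · rw [max_eq_right h]
      refine le_trans ?_ le_add_self
      have h2 : wt (k - m) ^ (s / 2) ≤ wt m ^ ((s - r) / 2) * wt (k - m) ^ (r / 2) := by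
        calc wt (k - m) ^ (s / 2) = wt (k - m) ^ ((s - r) / 2) * wt (k - m) ^ (r / 2) := by
              rw [← wt_rpow_add]; congr 1; ring
          _ ≤ _ := by
              refine mul_le_mul_left ?_ _
              have : (s - r) / 2 = -((r - s) / 2) := by ring
              rw [this, ENNReal.rpow_neg, ENNReal.rpow_neg]
              exact ENNReal.inv_le_inv.2 (ENNReal.rpow_le_rpow h (by linarith))
      refine (mul_le_mul_left h2 _).trans (le_of_eq ?_)
      simp only [hA', hB]; ring
  have hk : ∀ k, wt k ^ s * ‖c k‖ₑ ^ 2 ≤ 4 ^ s * 2 *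
      ((∑' m, B' m * A (k - m)) ^ 2 + (∑' m, A' m * B (k - m)) ^ 2) := by
    intro k
    have h4 : ((4 : ℝ≥0∞) ^ (s / 2)) ^ 2 = 4 ^ s := by
      rw [← ENNReal.rpow_natCast, ← ENNReal.rpow_mul]; norm_num
    rw [← wt_rpow_half_sq, ← mul_pow, ← h4, mul_assoc]
    have hsum : wt k ^ (s / 2) * ‖c k‖ₑ ≤
        4 ^ (s / 2) * ((∑' m, A m * B' (k - m)) + ∑' m, A' m * B (k - m)) := by
      refine (mul_le_mul_right (hc k) _).trans ?_
      rw [← ENNReal.tsum_mul_left, ← ENNReal.tsum_add, ← ENNReal.tsum_mul_left]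
      exact ENNReal.tsum_le_tsum (hpt k)
    -- The `ℓ¹` factor has to come first in `tsum_sq_conv_le`.
    have hswap : ∑' m, A m * B' (k - m) = ∑' m, B' m * A (k - m) := by
      rw [← (Equiv.subLeft k).tsum_eq]
      refine tsum_congr fun m => ?_
      simp [mul_comm]
    rw [hswap] at hsum
    refine (pow_le_pow_left' hsum 2).trans ?_
    rw [mul_pow]
    gcongr
    exact sq_add_le _ _
  refine (ENNReal.tsum_le_tsum hk).trans ?_
  rw [ENNReal.tsum_mul_left, ENNReal.tsum_add]
  have hY1 := tsum_sq_conv_le B' A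
  have hY2 := tsum_sq_conv_le A' B
  have hAe : ∑' m, A m ^ 2 = energy s a := by simp only [hA, mul_pow, wt_rpow_half_sq]; rfl
  have hBe : ∑' m, B m ^ 2 = energy r b := by simp only [hB, mul_pow, wt_rpow_half_sq]; rfl
  rw [hAe] at hY1
  rw [hBe] at hY2
  -- Both halves have the same bound, which turns the factor `2` into the `4` of `mulConst`.
  calc _ ≤ 4 ^ s * 2 * (embConst r * energy r b * energy s a
        + embConst r * energy s a * energy r b) := by
        gcongr
        · exact hY1.trans (mul_le_mul_left (sq_tsum_enorm_le r b) _)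
        · exact hY2.trans (mul_le_mul_left (sq_tsum_rpow_mul_enorm_le s r a) _)
    _ = _ := by rw [mulConst]; ring

/-! ### Interpolation between `H⁰` and `H¹` -/

/-- The squared K-functional of the couple `(H⁰, H¹)`. -/
noncomputable def kFunctional (t : ℝ) (a : ℤ → ℂ) : ℝ≥0∞ :=
  ∑' k : ℤ, ENNReal.ofReal ((1 + (k : ℝ) ^ 2) / (t + (1 + (k : ℝ) ^ 2))) * ‖a k‖ₑ ^ 2

theorem enorm_sq_eq_ofReal (z : ℂ) : ‖z‖ₑ ^ 2 = ENNReal.ofReal (‖z‖ ^ 2) := by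
  rw [← ofReal_norm, ENNReal.ofReal_pow (norm_nonneg _)]

/-- Frequency by frequency, with `x = 1 + k²`, the least value of `p² + t⁻¹ x r²` for fixed `p + r`
is `x / (t + x) · (p + r)²`; the defect is the explicit square in the proof. -/
theorem kFunctional_le {t : ℝ} (ht : 0 < t) {b b₀ b₁ : ℤ → ℂ} (hb : ∀ k, b k = b₀ k + b₁ k) :
    kFunctional t b ≤ energy 0 b₀ + ENNReal.ofReal t⁻¹ * energy 1 b₁ := by
  rw [energy_zero_left, energy, ← ENNReal.tsum_mul_left, ← ENNReal.tsum_add]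
  refine ENNReal.tsum_le_tsum fun k => ?_
  have hx : (0 : ℝ) < 1 + (k : ℝ) ^ 2 := by positivity
  rw [wt_rpow_eq_ofReal, Real.rpow_one, enorm_sq_eq_ofReal, enorm_sq_eq_ofReal,
    enorm_sq_eq_ofReal, ← ENNReal.ofReal_mul (by positivity), ← ENNReal.ofReal_mul hx.le,
    ← ENNReal.ofReal_mul (by positivity), ← ENNReal.ofReal_add (by positivity) (by positivity), hb]
  refine ENNReal.ofReal_le_ofReal ?_
  set x := 1 + (k : ℝ) ^ 2
  set p := ‖b₀ k‖
  set r := ‖b₁ k‖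
  have h1 : ‖b₀ k + b₁ k‖ ^ 2 ≤ (p + r) ^ 2 := by gcongr; exact norm_add_le _ _
  refine (mul_le_mul_of_nonneg_left h1 (by positivity)).trans ?_
  rw [← sub_nonneg]
  have : p ^ 2 + t⁻¹ * (x * r ^ 2) - x / (t + x) * (p + r) ^ 2 =
      (t * p - x * r) ^ 2 / (t * (t + x)) := by
    field_simp
    ring
  rw [this]
  positivity

/-- The splitting on the left is the minimiser of `kFunctional_le`, so equality holds there. -/
theorem energy_add_energy_eq_kFunctional {t : ℝ} (ht : 0 < t) (a : ℤ → ℂ) :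
    energy 0 (fun k => ((1 + (k : ℝ) ^ 2) / (t + (1 + (k : ℝ) ^ 2)) : ℝ) * a k) +
      ENNReal.ofReal t⁻¹ * energy 1 (fun k => (t / (t + (1 + (k : ℝ) ^ 2)) : ℝ) * a k) =
      kFunctional t a := by
  rw [energy_zero_left, energy, ← ENNReal.tsum_mul_left, ← ENNReal.tsum_add]
  refine tsum_congr fun k => ?_
  have hx : (0 : ℝ) < 1 + (k : ℝ) ^ 2 := by positivity
  rw [wt_rpow_eq_ofReal, Real.rpow_one, enorm_sq_eq_ofReal, enorm_sq_eq_ofReal,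
    enorm_sq_eq_ofReal, ← ENNReal.ofReal_mul (by positivity), ← ENNReal.ofReal_mul (by positivity),
    ← ENNReal.ofReal_mul (by positivity), ← ENNReal.ofReal_add (by positivity) (by positivity),
    norm_mul, norm_mul, Complex.norm_real, Complex.norm_real,
    Real.norm_of_nonneg (by positivity), Real.norm_of_nonneg (by positivity)]
  congr 1
  field_simp
  ring

/-- By scaling, `∫ t^{σ-1} x/(t + x) dt` over `t > 0` is `x^σ` times its value at `x = 1`. Taking `x
= 1 + k²` and summing over `k` recovers the `H^σ` energy from the K-functional. -/
theorem const_mul_energy_eq_lintegral {σ : ℝ} (hσ : σ ∈ Set.Ioo (0 : ℝ) 1) (a : ℤ → ℂ) :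
    ENNReal.ofReal (∫ t in Set.Ioi 0, Real.rpowIntegrand₀₁ σ t 1) * energy σ a =
      ∫⁻ t in Set.Ioi (0 : ℝ), ENNReal.ofReal (t ^ (σ - 1)) * kFunctional t a := by
  have h1 : ∀ k : ℤ, ENNReal.ofReal (∫ t in Set.Ioi 0, Real.rpowIntegrand₀₁ σ t 1) *
      (wt k ^ σ * ‖a k‖ₑ ^ 2) = ∫⁻ t in Set.Ioi (0 : ℝ), ENNReal.ofReal (t ^ (σ - 1)) *
        (ENNReal.ofReal ((1 + (k : ℝ) ^ 2) / (t + (1 + (k : ℝ) ^ 2))) * ‖a k‖ₑ ^ 2) := by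
    intro k
    have hx : (0 : ℝ) < 1 + (k : ℝ) ^ 2 := by positivity
    rw [← mul_assoc, mul_comm (ENNReal.ofReal _), wt_rpow_eq_ofReal,
      ← ENNReal.ofReal_mul (by positivity),
      ← Real.integral_rpowIntegrand₀₁_eq_rpow_mul_const hσ hx.le,
      ofReal_integral_eq_lintegral_ofReal (Real.integrableOn_rpowIntegrand₀₁_Ioi hσ hx.le),
      ← lintegral_mul_const' _ _ (by finiteness)]
    · refine setLIntegral_congr_fun measurableSet_Ioi fun t ht => ?_
      have ht' : (0 : ℝ) < t := ht
      rw [Real.rpowIntegrand₀₁_eq_pow_div hσ ht'.le hx.le, mul_div_assoc,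
        ENNReal.ofReal_mul (by positivity), mul_assoc]
    · refine (ae_restrict_iff' measurableSet_Ioi).2 (Eventually.of_forall fun t ht => ?_)
      exact Real.rpowIntegrand₀₁_nonneg hσ.1 (le_of_lt ht) hx.le
  rw [energy, ← ENNReal.tsum_mul_left, tsum_congr h1, ← lintegral_tsum]
  · simp only [ENNReal.tsum_mul_left]
    rfl
  · intro k
    have : Measurable fun t : ℝ => ENNReal.ofReal (t ^ (σ - 1)) *
        (ENNReal.ofReal ((1 + (k : ℝ) ^ 2) / (t + (1 + (k : ℝ) ^ 2))) * ‖a k‖ₑ ^ 2) := by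
      fun_prop
    exact this.aemeasurable

/-- Interpolation between `H⁰` and `H¹` through the K-functional. -/
theorem energy_le_of_kFunctional_le {σ : ℝ} (hσ : σ ∈ Set.Ioo (0 : ℝ) 1) {a b : ℤ → ℂ} {M : ℝ≥0∞}
    (hM : M ≠ ⊤) (h : ∀ t, 0 < t → kFunctional t b ≤ M * kFunctional t a) :
    energy σ b ≤ M * energy σ a := by
  have hc := Real.integral_rpowIntegrand₀₁_one_pos hσ
  have hc0 : ENNReal.ofReal (∫ t in Set.Ioi 0, Real.rpowIntegrand₀₁ σ t 1) ≠ 0 := by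
    simpa using hc
  rw [← ENNReal.mul_le_mul_iff_right hc0 ENNReal.ofReal_ne_top, mul_left_comm,
    const_mul_energy_eq_lintegral hσ, const_mul_energy_eq_lintegral hσ,
    ← lintegral_const_mul' _ _ hM]
  refine setLIntegral_mono' measurableSet_Ioi fun t ht => ?_
  rw [mul_left_comm]
  gcongr
  exact h t ht

/-! ### Functions on the circle: Parseval, products, derivatives -/

/-- Two functions on the circle, the second of which is continuous and is the derivative of the
first. -/
def IsDeriv (f f' : UnitAddCircle → ℂ) : Prop :=
  Continuous f' ∧ ∀ x : ℝ, HasDerivAt (fun t : ℝ => f (t : UnitAddCircle)) (f' x) x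

theorem haarAddCircle_eq_volume :
    (AddCircle.haarAddCircle : Measure UnitAddCircle) = volume := by
  rw [AddCircle.volume_eq_smul_haarAddCircle]; simp

theorem memLp_of_continuous {f : UnitAddCircle → ℂ} (hf : Continuous f) (p : ℝ≥0∞) :
    MemLp f p AddCircle.haarAddCircle := by
  obtain ⟨C, hC⟩ := (isCompact_range hf).isBounded.exists_norm_le
  exact MemLp.of_bound hf.aestronglyMeasurable C
    (Eventually.of_forall fun x => hC _ (Set.mem_range_self x))

theorem integrable_of_memLp {f : UnitAddCircle → ℂ} (hf : MemLp f 2 AddCircle.haarAddCircle) :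
    Integrable f AddCircle.haarAddCircle := hf.integrable (by norm_num)

/-- Parseval's identity. -/
theorem energy_zero_fourierCoeff {f : UnitAddCircle → ℂ}
    (hf : MemLp f 2 AddCircle.haarAddCircle) :
    energy 0 (fourierCoeff f) = ∫⁻ x, ‖f x‖ₑ ^ 2 ∂AddCircle.haarAddCircle := by
  have h := hasSum_sq_fourierCoeff hf.toLp
  rw [fourierCoeff_congr_ae hf.coeFn_toLp] at h
  have h2 : ∫ t, ‖hf.toLp f t‖ ^ 2 ∂AddCircle.haarAddCircle =
      ∫ t, ‖f t‖ ^ 2 ∂AddCircle.haarAddCircle := by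
    refine integral_congr_ae ?_
    filter_upwards [hf.coeFn_toLp] with x hx
    rw [hx]
  rw [h2] at h
  have hint : Integrable (fun t => ‖f t‖ ^ 2) (AddCircle.haarAddCircle : Measure UnitAddCircle) :=
    hf.integrable_norm_pow (by norm_num)
  simp_rw [energy_zero_left, enorm_sq_eq_ofReal]
  rw [← ENNReal.ofReal_tsum_of_nonneg (fun k => by positivity) h.summable, h.tsum_eq,
    ofReal_integral_eq_lintegral_ofReal hint (Eventually.of_forall fun x => by positivity)]

theorem energy_zero_fourierCoeff_ne_top {f : UnitAddCircle → ℂ}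
    (hf : MemLp f 2 AddCircle.haarAddCircle) : energy 0 (fourierCoeff f) ≠ ⊤ := by
  rw [energy_zero_fourierCoeff hf]
  have := hf.eLpNorm_lt_top
  rw [eLpNorm_lt_top_iff_lintegral_rpow_enorm_lt_top (by norm_num) (by norm_num)] at this
  norm_num at this
  exact this.ne

theorem energy_zero_le_of_bound {f : UnitAddCircle → ℂ} (hf : Continuous f) {C : ℝ≥0∞}
    (hC : ∀ x, ‖f x‖ₑ ^ 2 ≤ C) : energy 0 (fourierCoeff f) ≤ C := by
  rw [energy_zero_fourierCoeff (memLp_of_continuous hf 2)]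
  exact (lintegral_mono hC).trans (by simp)

/-- Parseval for the inner product of `f` with `conj h · e_k` writes the coefficient of the product
as a convolution; the triangle inequality does the rest. -/
theorem fourierCoeff_mul_enorm_le {f h : UnitAddCircle → ℂ} (hf : Continuous f)
    (hh : Continuous h) (k : ℤ) :
    ‖fourierCoeff (fun x => f x * h x) k‖ₑ ≤
      ∑' m, ‖fourierCoeff f m‖ₑ * ‖fourierCoeff h (k - m)‖ₑ := by
  let F : C(UnitAddCircle, ℂ) := ⟨f, hf⟩
  let G : C(UnitAddCircle, ℂ) := star (⟨h, hh⟩ : C(UnitAddCircle, ℂ)) * fourier k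
  have key := (fourierBasis (T := 1)).hasSum_inner_mul_inner
    (ContinuousMap.toLp 2 AddCircle.haarAddCircle ℂ G)
    (ContinuousMap.toLp 2 AddCircle.haarAddCircle ℂ F)
  simp only [coe_fourierBasis, fourierLp, ContinuousMap.inner_toLp] at key
  have h1 : ∫ x, F x * (starRingEnd ℂ) (G x) ∂AddCircle.haarAddCircle =
      fourierCoeff (fun x => f x * h x) k := by
    refine integral_congr_ae (Eventually.of_forall fun x => ?_)
    simp [F, G, fourier_neg, -fourier_apply]
    ring
  have h2 : ∀ m, ∫ x, fourier m x * (starRingEnd ℂ) (G x) ∂AddCircle.haarAddCircle =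
      fourierCoeff h (k - m) := by
    intro m
    refine integral_congr_ae (Eventually.of_forall fun x => ?_)
    simp only [G, ContinuousMap.mul_apply, ContinuousMap.star_apply, ContinuousMap.coe_mk,
      map_mul, smul_eq_mul, neg_sub]
    rw [sub_eq_add_neg, fourier_add, fourier_neg]
    simp
    ring
  have h3 : ∀ m, ∫ x, F x * (starRingEnd ℂ) (fourier m x) ∂AddCircle.haarAddCircle =
      fourierCoeff f m := by
    intro m
    refine integral_congr_ae (Eventually.of_forall fun x => ?_)
    simp [F, fourier_neg, -fourier_apply]
    ring
  rw [h1] at key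
  simp only [h2, h3] at key
  rw [← key.tsum_eq]
  refine enorm_tsum_le_tsum_enorm.trans (ENNReal.tsum_le_tsum fun m => ?_)
  rw [enorm_mul, mul_comm]

/-- The multiplication theorem `H^s · H^r ⊆ H^s` for `0 ≤ s ≤ r` and `r > 1/2`. -/
theorem energy_mul_le {s r : ℝ} (hs : 0 ≤ s) (hsr : s ≤ r) {f h : UnitAddCircle → ℂ}
    (hf : Continuous f) (hh : Continuous h) :
    energy s (fourierCoeff fun x => f x * h x) ≤
      mulConst s r * energy s (fourierCoeff f) * energy r (fourierCoeff h) :=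
  energy_conv_le hs hsr (fourierCoeff_mul_enorm_le hf hh)

/-- The Sobolev embedding `H^r ⊆ C⁰` for `r > 1/2`. -/
theorem sq_enorm_le_embConst_mul {r : ℝ} (hr : 1 / 2 < r) {f : UnitAddCircle → ℂ}
    (hf : Continuous f) (x : UnitAddCircle) :
    ‖f x‖ₑ ^ 2 ≤ embConst r * energy r (fourierCoeff f) := by
  -- With infinite energy the right side is `⊤`, because `embConst r` is nonzero: its term at `k =
  -- 0` is `1`.
  by_cases htop : energy r (fourierCoeff f) = ⊤
  · rw [htop, ENNReal.mul_top]
    · exact le_top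
    · exact ((zero_lt_one.trans_le (by simp [wt])).trans_le (ENNReal.le_tsum 0)).ne'
  have hfin : ∑' k, ‖fourierCoeff f k‖ₑ ≠ ⊤ := by
    intro h
    have := sq_tsum_enorm_le r (fourierCoeff f)
    rw [h] at this
    simp only [ne_eq, OfNat.ofNat_ne_zero, not_false_eq_true, ENNReal.top_pow, top_le_iff] at this
    exact ENNReal.mul_ne_top (embConst_ne_top hr) htop this
  have hsum : Summable (fourierCoeff (⟨f, hf⟩ : C(UnitAddCircle, ℂ))) := by
    apply Summable.of_enorm
    exact hfin
  have hx := has_pointwise_sum_fourier_series_of_summable hsum x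
  refine le_trans ?_ (sq_tsum_enorm_le r (fourierCoeff f))
  gcongr
  change ‖(⟨f, hf⟩ : C(UnitAddCircle, ℂ)) x‖ₑ ≤ _
  rw [← hx.tsum_eq]
  refine enorm_tsum_le_tsum_enorm.trans (ENNReal.tsum_le_tsum fun m => ?_)
  rw [smul_eq_mul, enorm_mul]
  have : ‖(fourier m x : ℂ)‖ₑ = 1 := by
    rw [← ofReal_norm, fourier_apply, Circle.norm_coe, ENNReal.ofReal_one]
  rw [this, mul_one]
  rfl

theorem IsDeriv.continuous {f f' : UnitAddCircle → ℂ} (h : IsDeriv f f') : Continuous f := by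
  have : Continuous fun t : ℝ => f (t : UnitAddCircle) :=
    continuous_iff_continuousAt.2 fun x => (h.2 x).continuousAt
  exact (QuotientAddGroup.isQuotientMap_mk (N := AddSubgroup.zmultiples (1 : ℝ))).continuous_iff.2
    this

theorem IsDeriv.fourierCoeff_eq {f f' : UnitAddCircle → ℂ} (h : IsDeriv f f') (k : ℤ) :
    fourierCoeff f' k = 2 * Real.pi * Complex.I * k * fourierCoeff f k := by
  have hf := h.continuous
  have hc : Continuous ((↑) : ℝ → UnitAddCircle) := AddCircle.continuous_mk' 1
  have h1 := fourierCoeff_eq_intervalIntegral f k 0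
  have h2 := fourierCoeff_eq_intervalIntegral f' k 0
  simp only [smul_eq_mul, zero_add, ne_eq, one_ne_zero, not_false_eq_true, div_self,
    one_smul] at h1 h2
  have hd : ∀ x ∈ Set.uIcc (0 : ℝ) 1, HasDerivAt
      (fun t : ℝ => (fourier (-k) (t : UnitAddCircle) : ℂ) * f (t : UnitAddCircle))
      ((-2 * Real.pi * Complex.I * k / (1 : ℝ) * fourier (-k) (x : UnitAddCircle)) * f x
        + fourier (-k) (x : UnitAddCircle) * f' x) x := fun x _ =>
    (hasDerivAt_fourier_neg 1 k x).mul (h.2 x)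
  have hF : Continuous fun x : ℝ => (fourier (-k) (x : UnitAddCircle) : ℂ) :=
    (map_continuous _).comp hc
  have i1 : IntervalIntegrable (fun x : ℝ => (-2 * Real.pi * Complex.I * k / (1 : ℝ) *
      fourier (-k) (x : UnitAddCircle)) * f x) volume 0 1 :=
    ((continuous_const.mul hF).mul (hf.comp hc)).intervalIntegrable _ _
  have i2 : IntervalIntegrable (fun x : ℝ => fourier (-k) (x : UnitAddCircle) * f' x)
      volume 0 1 := (hF.mul (h.1.comp hc)).intervalIntegrable _ _
  have hI := intervalIntegral.integral_eq_sub_of_hasDerivAt hd (i1.add i2)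
  rw [intervalIntegral.integral_add i1 i2] at hI
  -- Periodicity cancels the boundary terms of the integration by parts.
  have hper : ((1 : ℝ) : UnitAddCircle) = ((0 : ℝ) : UnitAddCircle) := by
    simp
  rw [hper, sub_self, ← h2] at hI
  simp only [mul_assoc, intervalIntegral.integral_const_mul] at hI
  simp only [div_eq_mul_inv, mul_assoc] at hI
  rw [← h1] at hI
  simp only [Complex.ofReal_one, inv_one, one_mul] at hI
  linear_combination hI

/-- Since `1 + k² ≤ 1 + (2πk)²`, no constant is needed. This is the step by which regularity is
raised by one throughout. -/
theorem IsDeriv.energy_succ_le {f f' : UnitAddCircle → ℂ} (h : IsDeriv f f') (s : ℝ) :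
    energy (s + 1) (fourierCoeff f) ≤ energy s (fourierCoeff f) + energy s (fourierCoeff f') := by
  rw [energy, energy, energy, ← ENNReal.tsum_add]
  refine ENNReal.tsum_le_tsum fun k => ?_
  rw [wt_rpow_add, mul_assoc, ← mul_add]
  gcongr
  rw [wt_rpow_eq_ofReal, Real.rpow_one, h.fourierCoeff_eq, enorm_sq_eq_ofReal, enorm_sq_eq_ofReal,
    ← ENNReal.ofReal_mul (by positivity), ← ENNReal.ofReal_add (by positivity) (by positivity)]
  refine ENNReal.ofReal_le_ofReal ?_
  simp only [norm_mul, mul_pow, Complex.norm_I, Complex.norm_intCast, Complex.norm_real,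
    Real.norm_eq_abs, sq_abs, RCLike.norm_ofNat]
  have hpi : 1 ≤ Real.pi ^ 2 := by nlinarith [Real.pi_gt_three]
  have : 0 ≤ (k : ℝ) ^ 2 * ‖fourierCoeff f k‖ ^ 2 := by positivity
  nlinarith

/-- The constant of the bound of `d/dx : H^{s+1} → H^s`. -/
noncomputable def derivConst : ℝ≥0∞ := ENNReal.ofReal ((2 * Real.pi) ^ 2)

theorem derivConst_ne_top : derivConst ≠ ⊤ := ENNReal.ofReal_ne_top

theorem IsDeriv.energy_le {f f' : UnitAddCircle → ℂ} (h : IsDeriv f f') (s : ℝ) :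
    energy s (fourierCoeff f') ≤ derivConst * energy (s + 1) (fourierCoeff f) := by
  rw [energy, energy, ← ENNReal.tsum_mul_left]
  refine ENNReal.tsum_le_tsum fun k => ?_
  rw [wt_rpow_add, mul_assoc, mul_left_comm]
  gcongr
  rw [wt_rpow_eq_ofReal, Real.rpow_one, h.fourierCoeff_eq, enorm_sq_eq_ofReal, enorm_sq_eq_ofReal,
    derivConst, ← ENNReal.ofReal_mul (by positivity), ← ENNReal.ofReal_mul (by positivity)]
  refine ENNReal.ofReal_le_ofReal ?_
  simp only [norm_mul, mul_pow, Complex.norm_I, Complex.norm_intCast, Complex.norm_real,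
    Real.norm_eq_abs, sq_abs, RCLike.norm_ofNat]
  have : 0 ≤ Real.pi ^ 2 * ‖fourierCoeff f k‖ ^ 2 := by positivity
  nlinarith

/-! ### Change of variables under circle maps -/

/-- The circle map `χ` has a `C¹` lift of degree one, whose derivative is the function `v` on the
circle. -/
structure HasLiftDeriv (χ : UnitAddCircle → UnitAddCircle) (v : UnitAddCircle → ℝ) : Prop where
  continuous_deriv : Continuous v
  exists_lift : ∃ X : ℝ → ℝ, (∀ t : ℝ, (X t : UnitAddCircle) = χ t) ∧
    (∀ t : ℝ, HasDerivAt X (v t) t) ∧ X 1 = X 0 + 1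

theorem continuous_of_continuous_comp_coe {Y : Type*} [TopologicalSpace Y] {f : UnitAddCircle → Y}
    (h : Continuous fun t : ℝ => f (t : UnitAddCircle)) : Continuous f :=
  (QuotientAddGroup.isQuotientMap_mk (N := AddSubgroup.zmultiples (1 : ℝ))).continuous_iff.2 h

namespace HasLiftDeriv

variable {χ : UnitAddCircle → UnitAddCircle} {v : UnitAddCircle → ℝ}

theorem continuous (h : HasLiftDeriv χ v) : Continuous χ := by
  obtain ⟨X, hX, hd, -⟩ := h.exists_lift
  refine continuous_of_continuous_comp_coe ?_
  simp_rw [← hX]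
  exact (AddCircle.continuous_mk' 1).comp
    (continuous_iff_continuousAt.2 fun x => (hd x).continuousAt)

/-- Change of variables. -/
theorem lintegral_comp_le (h : HasLiftDeriv χ v) {m : ℝ} (hm : 0 < m) (hv : ∀ x, m ≤ v x)
    (F : UnitAddCircle → ℝ≥0∞) :
    ∫⁻ x, F (χ x) ∂AddCircle.haarAddCircle ≤
      ENNReal.ofReal m⁻¹ * ∫⁻ x, F x ∂AddCircle.haarAddCircle := by
  obtain ⟨X, hX, hd, h1⟩ := h.exists_lift
  have hmono : StrictMono X := strictMono_of_deriv_pos fun t => by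
    rw [(hd t).deriv]; exact hm.trans_le (hv _)
  rw [haarAddCircle_eq_volume, ← UnitAddCircle.lintegral_preimage 0,
    ← UnitAddCircle.lintegral_preimage (X 0)]
  have key := lintegral_image_eq_lintegral_abs_deriv_mul (s := Set.Ioc (0 : ℝ) (0 + 1))
    measurableSet_Ioc (fun t _ => (hd t).hasDerivWithinAt) hmono.injective.injOn
    fun y => F (y : UnitAddCircle)
  -- Degree one keeps the image of a period within a single period, so nothing is counted twice.
  have hsub : X '' Set.Ioc (0 : ℝ) (0 + 1) ⊆ Set.Ioc (X 0) (X 0 + 1) := by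
    rintro _ ⟨t, ht, rfl⟩
    refine ⟨hmono ht.1, ?_⟩
    rw [← h1]
    exact hmono.monotone (by simpa using ht.2)
  calc ∫⁻ a in Set.Ioc (0 : ℝ) (0 + 1), F (χ a)
      ≤ ∫⁻ a in Set.Ioc (0 : ℝ) (0 + 1), ENNReal.ofReal m⁻¹ *
          (ENNReal.ofReal |v a| * F (X a)) := by
        refine lintegral_mono fun t => ?_
        rw [hX, ← mul_assoc, ← ENNReal.ofReal_mul (by positivity)]
        refine le_mul_of_one_le_left' ?_
        rw [ENNReal.one_le_ofReal, abs_of_pos (hm.trans_le (hv _)), ← div_eq_inv_mul,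
          one_le_div hm]
        exact hv _
    _ = ENNReal.ofReal m⁻¹ * ∫⁻ y in X '' Set.Ioc (0 : ℝ) (0 + 1), F y := by
        rw [lintegral_const_mul' _ _ ENNReal.ofReal_ne_top, key]
    _ ≤ _ := by
        gcongr

/-- The change of variables bound applied to indicators. It is what makes `u ∘ χ` meaningful for
almost-everywhere classes. -/
theorem quasiMeasurePreserving (h : HasLiftDeriv χ v) {m : ℝ} (hm : 0 < m) (hv : ∀ x, m ≤ v x) :
    Measure.QuasiMeasurePreserving χ AddCircle.haarAddCircle AddCircle.haarAddCircle := by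
  refine ⟨h.continuous.measurable, Measure.AbsolutelyContinuous.mk fun s hs h0 => ?_⟩
  rw [Measure.map_apply h.continuous.measurable hs]
  have := h.lintegral_comp_le hm hv (s.indicator 1)
  rw [lintegral_indicator_one hs, h0, mul_zero] at this
  have h2 : ∫⁻ x, s.indicator 1 (χ x) ∂AddCircle.haarAddCircle =
      (AddCircle.haarAddCircle : Measure UnitAddCircle) (χ ⁻¹' s) := by
    rw [← lintegral_indicator_one (h.continuous.measurable hs)]
    rfl
  rw [h2] at this
  exact le_antisymm this zero_le

theorem memLp_comp (h : HasLiftDeriv χ v) {m : ℝ} (hm : 0 < m) (hv : ∀ x, m ≤ v x)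
    {E : Type*} [NormedAddCommGroup E] {f : UnitAddCircle → E}
    (hf : MemLp f 2 AddCircle.haarAddCircle) :
    MemLp (f ∘ χ) 2 AddCircle.haarAddCircle := by
  refine ⟨hf.1.comp_quasiMeasurePreserving (h.quasiMeasurePreserving hm hv), ?_⟩
  have h2 := hf.2
  rw [eLpNorm_lt_top_iff_lintegral_rpow_enorm_lt_top (by norm_num) (by norm_num)] at h2 ⊢
  exact (h.lintegral_comp_le hm hv fun x => ‖f x‖ₑ ^ (2 : ℝ≥0∞).toReal).trans_lt
    (ENNReal.mul_lt_top ENNReal.ofReal_lt_top h2)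

end HasLiftDeriv

theorem IsDeriv.comp {f f' : UnitAddCircle → ℂ} (hf : IsDeriv f f')
    {χ : UnitAddCircle → UnitAddCircle} {v : UnitAddCircle → ℝ} (h : HasLiftDeriv χ v) :
    IsDeriv (f ∘ χ) fun x => f' (χ x) * v x := by
  refine ⟨(hf.1.comp h.continuous).mul (Complex.continuous_ofReal.comp h.continuous_deriv),
    fun x => ?_⟩
  obtain ⟨X, hX, hd, -⟩ := h.exists_lift
  have := (hf.2 (X x)).scomp x (hd x)
  rw [hX, Complex.real_smul, mul_comm] at this
  refine this.congr_of_eventuallyEq (Eventually.of_forall fun t => ?_)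
  simp [hX]

/-! ### Approximation by trigonometric polynomials -/

/-- Trigonometric polynomials. -/
noncomputable def trig (F : Finset ℤ) (c : ℤ → ℂ) (x : UnitAddCircle) : ℂ :=
  ∑ k ∈ F, c k * fourier k x

theorem continuous_trig (F : Finset ℤ) (c : ℤ → ℂ) : Continuous (trig F c) :=
  continuous_finsetSum _ fun k _ => continuous_const.mul (map_continuous (fourier k))

theorem fourierCoeff_trig (F : Finset ℤ) (c : ℤ → ℂ) (k : ℤ) :
    fourierCoeff (trig F c) k = if k ∈ F then c k else 0 := by
  have h : trig F c = ∑ j ∈ F, fun x => c j * (fourier j x : ℂ) := by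
    ext x; simp [trig]
  rw [h, fourierCoeff.sum]
  · simp only [Finset.sum_apply, fourierCoeff.const_mul, fourierCoeff_fourier]
    simp [Pi.single_apply]
  · intro j _
    exact integrable_of_memLp (memLp_of_continuous
      (continuous_const.mul (map_continuous (fourier j))) 2)

theorem isDeriv_trig (F : Finset ℤ) (c : ℤ → ℂ) :
    IsDeriv (trig F c) (trig F fun k => 2 * Real.pi * Complex.I * k * c k) := by
  refine ⟨continuous_trig _ _, fun x => ?_⟩
  unfold trig
  refine HasDerivAt.fun_sum fun k _ => ?_
  exact ((hasDerivAt_fourier 1 k x).const_mul (c k)).congr_deriv (by push_cast; ring)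

theorem energy_fourierCoeff_trig_le (s : ℝ) (F : Finset ℤ) (a : ℤ → ℂ) :
    energy s (fourierCoeff (trig F a)) ≤ energy s a := by
  refine energy_mono_seq s fun k => ?_
  rw [fourierCoeff_trig]
  split_ifs <;> simp

theorem fourierCoeff_sub {f g : UnitAddCircle → ℂ} (hf : MemLp f 2 AddCircle.haarAddCircle)
    (hg : MemLp g 2 AddCircle.haarAddCircle) :
    fourierCoeff (f - g) = fourierCoeff f - fourierCoeff g := by
  rw [eq_sub_iff_add_eq, ← fourierCoeff.add (integrable_of_memLp (hf.sub hg))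
    (integrable_of_memLp hg), sub_add_cancel]

/-- The energy of the Fourier tails tends to zero. -/
theorem tendsto_energy_sub_trig {s : ℝ} {f : UnitAddCircle → ℂ}
    (hf : MemLp f 2 AddCircle.haarAddCircle) (hs : energy s (fourierCoeff f) ≠ ⊤) :
    Tendsto (fun F : Finset ℤ => energy s (fourierCoeff (f - trig F (fourierCoeff f)))) atTop
      (𝓝 0) := by
  have h := ENNReal.tendsto_tsum_compl_atTop_zero hs
  refine h.congr fun F => ?_
  have hk : ∀ k, fourierCoeff (f - trig F (fourierCoeff f)) k =
      if k ∈ F then 0 else fourierCoeff f k := fun k => by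
    rw [fourierCoeff_sub hf (memLp_of_continuous (continuous_trig _ _) 2), Pi.sub_apply,
      fourierCoeff_trig]
    split_ifs <;> simp
  simp only [energy, hk]
  rw [← Function.Injective.tsum_eq (Subtype.val_injective (p := fun k => k ∉ F))]
  · exact tsum_congr fun k => by rw [if_neg k.2]
  · intro k hk
    refine ⟨⟨k, fun hkF => hk ?_⟩, rfl⟩
    simp [hkF]

/-! ### Boundedness of composition on the Sobolev scale -/

/-- Composition with `χ` is bounded in the squared `H^s` norm by `C`. -/
def CompBound (χ : UnitAddCircle → UnitAddCircle) (s : ℝ) (C : ℝ≥0∞) : Prop :=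
  ∀ f : UnitAddCircle → ℂ, MemLp f 2 AddCircle.haarAddCircle →
    energy s (fourierCoeff (f ∘ χ)) ≤ C * energy s (fourierCoeff f)

theorem CompBound.mono {χ : UnitAddCircle → UnitAddCircle} {s : ℝ} {C D : ℝ≥0∞}
    (h : CompBound χ s C) (hCD : C ≤ D) : CompBound χ s D :=
  fun f hf => (h f hf).trans (by gcongr)

section Composition

variable {χ : UnitAddCircle → UnitAddCircle} {v : UnitAddCircle → ℝ} {m : ℝ}

theorem HasLiftDeriv.compBound_zero (h : HasLiftDeriv χ v) (hm : 0 < m) (hv : ∀ x, m ≤ v x) :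
    CompBound χ 0 (ENNReal.ofReal m⁻¹) := fun f hf => by
  rw [energy_zero_fourierCoeff hf, energy_zero_fourierCoeff (h.memLp_comp hm hv hf)]
  exact h.lintegral_comp_le hm hv fun x => ‖f x‖ₑ ^ 2

theorem tendsto_zero_of_sq {ι : Type*} {l : Filter ι} {g : ι → ℝ≥0∞}
    (h : Tendsto (fun i => g i ^ 2) l (𝓝 0)) : Tendsto g l (𝓝 0) := by
  have h1 := ((ENNReal.continuous_rpow_const (y := 1 / 2)).tendsto 0).comp h
  rw [ENNReal.zero_rpow_of_pos (by norm_num)] at h1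
  refine h1.congr fun i => ?_
  rw [Function.comp_apply, ← ENNReal.rpow_natCast, ← ENNReal.rpow_mul]
  norm_num

/-- A bound on trigonometric polynomials extends to all functions. -/
theorem HasLiftDeriv.compBound_of_trig (h : HasLiftDeriv χ v) (hm : 0 < m) (hv : ∀ x, m ≤ v x)
    {s : ℝ} {C : ℝ≥0∞} (hC : ∀ F c, energy s (fourierCoeff (trig F c ∘ χ)) ≤
      C * energy s (fourierCoeff (trig F c))) : CompBound χ s C := by
  intro f hf
  have htrig : ∀ F, MemLp (trig F (fourierCoeff f)) 2 AddCircle.haarAddCircle :=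
    fun F => memLp_of_continuous (continuous_trig _ _) 2
  -- The partial Fourier sums converge to `f` in `L²`, and composition is bounded on `L²`. Hence
  -- each coefficient of the compositions converges, and lower semicontinuity of the energy
  -- transfers the bound.
  refine energy_le_of_tendsto (l := (atTop : Filter (Finset ℤ))) s
    (a := fun F => fourierCoeff (trig F (fourierCoeff f) ∘ χ)) (fun k => ?_) fun F =>
      (hC F _).trans (by gcongr; exact energy_fourierCoeff_trig_le s F _)
  have h0 := ENNReal.Tendsto.const_mul (a := ENNReal.ofReal m⁻¹)
    (tendsto_energy_sub_trig hf (energy_zero_fourierCoeff_ne_top hf)) (Or.inr (by simp))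
  rw [mul_zero] at h0
  have h1 : Tendsto (fun F => ‖fourierCoeff (f ∘ χ) k -
      fourierCoeff (trig F (fourierCoeff f) ∘ χ) k‖ₑ ^ 2) atTop (𝓝 0) := by
    refine tendsto_of_tendsto_of_tendsto_of_le_of_le tendsto_const_nhds h0 (fun _ => zero_le)
      fun F => ?_
    have h2 := h.compBound_zero hm hv _ (hf.sub (htrig F))
    refine le_trans ?_ h2
    have h3 : (f - trig F (fourierCoeff f)) ∘ χ = f ∘ χ - trig F (fourierCoeff f) ∘ χ := rfl
    rw [h3, fourierCoeff_sub (h.memLp_comp hm hv hf) (h.memLp_comp hm hv (htrig F))]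
    exact sq_enorm_le_energy le_rfl
      (fourierCoeff (f ∘ χ) - fourierCoeff (trig F (fourierCoeff f) ∘ χ)) k
  have h4 : Tendsto (fun F => ‖fourierCoeff (f ∘ χ) k -
      fourierCoeff (trig F (fourierCoeff f) ∘ χ) k‖ₑ) atTop (𝓝 0) := tendsto_zero_of_sq h1
  rw [tendsto_iff_edist_tendsto_0]
  refine h4.congr fun F => ?_
  rw [edist_comm, edist_eq_enorm_sub]

/-- On trigonometric polynomials the optimal splitting of the coefficients is a splitting into
functions `trig F a₀ + trig F a₁`. Composing each piece and using the two endpoint bounds gives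
`K(t, f ∘ χ) ≤ C · K(t, f)` for all `t > 0`. -/
theorem HasLiftDeriv.compBound_interpolate (h : HasLiftDeriv χ v) (hm : 0 < m)
    (hv : ∀ x, m ≤ v x) {C : ℝ≥0∞} (hC : C ≠ ⊤) (h0 : CompBound χ 0 C) (h1 : CompBound χ 1 C)
    {σ : ℝ} (hσ0 : 0 ≤ σ) (hσ1 : σ ≤ 1) : CompBound χ σ C := by
  rcases hσ0.eq_or_lt with rfl | hσ0
  · exact h0
  rcases hσ1.eq_or_lt with rfl | hσ1
  · exact h1
  refine h.compBound_of_trig hm hv fun F c => ?_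
  refine energy_le_of_kFunctional_le ⟨hσ0, hσ1⟩ hC fun t ht => ?_
  set a₀ : ℤ → ℂ := fun k => ((1 + (k : ℝ) ^ 2) / (t + (1 + (k : ℝ) ^ 2)) : ℝ) * c k with ha₀
  set a₁ : ℤ → ℂ := fun k => (t / (t + (1 + (k : ℝ) ^ 2)) : ℝ) * c k with ha₁
  have hc : ∀ k, c k = a₀ k + a₁ k := fun k => by
    simp only [ha₀, ha₁]
    rw [← add_mul, ← Complex.ofReal_add, ← add_div, add_comm _ t, div_self (by positivity)]
    simp
  have hsplit : trig F c = trig F a₀ + trig F a₁ := by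
    ext x
    simp only [trig, Pi.add_apply, ← Finset.sum_add_distrib, ← add_mul, ← hc]
  have hcont : ∀ a, Continuous (trig F a ∘ χ) := fun a => (continuous_trig F a).comp h.continuous
  have hmem : ∀ a, MemLp (trig F a) 2 AddCircle.haarAddCircle := fun a =>
    memLp_of_continuous (continuous_trig F a) 2
  have hcoef : fourierCoeff (trig F c ∘ χ) =
      fourierCoeff (trig F a₀ ∘ χ) + fourierCoeff (trig F a₁ ∘ χ) := by
    rw [hsplit, ← fourierCoeff.add (integrable_of_memLp (memLp_of_continuous (hcont _) 2))
      (integrable_of_memLp (memLp_of_continuous (hcont _) 2))]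
    rfl
  refine (kFunctional_le ht (b₀ := fourierCoeff (trig F a₀ ∘ χ))
    (b₁ := fourierCoeff (trig F a₁ ∘ χ)) fun k => by rw [hcoef]; rfl).trans ?_
  rw [← energy_add_energy_eq_kFunctional ht, mul_add, mul_left_comm]
  gcongr
  · refine (h0 _ (hmem a₀)).trans (mul_le_mul_right (energy_mono_seq _ fun k => le_of_eq ?_) _)
    rw [fourierCoeff_trig, fourierCoeff_trig]
    split_ifs <;> simp [ha₀]
  · refine (h1 _ (hmem a₁)).trans (mul_le_mul_right (energy_mono_seq _ fun k => le_of_eq ?_) _)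
    rw [fourierCoeff_trig, fourierCoeff_trig]
    split_ifs <;> simp [ha₁]

/-- The chain rule reduces `H^{s+1}` to two bounds on `H^s`: one for `f ∘ χ` and one for `(f' ∘ χ)
v`. -/
theorem HasLiftDeriv.compBound_succ (h : HasLiftDeriv χ v) (hm : 0 < m) (hv : ∀ x, m ≤ v x)
    {s : ℝ} {C D : ℝ≥0∞} (hC : CompBound χ s C)
    (hD : ∀ f : UnitAddCircle → ℂ, Continuous f →
      energy s (fourierCoeff fun x => f (χ x) * v x) ≤ D * energy s (fourierCoeff f)) :
    CompBound χ (s + 1) (C + D * derivConst) := by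
  refine h.compBound_of_trig hm hv fun F c => ?_
  have hd := isDeriv_trig F c
  refine ((hd.comp h).energy_succ_le s).trans ?_
  rw [add_mul, mul_assoc D]
  gcongr
  · refine (hC _ (memLp_of_continuous hd.continuous 2)).trans ?_
    gcongr
    exact energy_mono (by linarith) _
  · refine (hD _ hd.1).trans ?_
    gcongr
    exact hd.energy_le s

/-- The bound for `u ↦ (u ∘ χ) v` in `H^s`, `0 ≤ s ≤ r`, in terms of that for `u ↦ u ∘ χ`. -/
def CompMulBound (χ : UnitAddCircle → UnitAddCircle) (v : UnitAddCircle → ℝ) (r : ℝ)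
    (K : ℝ≥0∞) : Prop :=
  ∀ (s : ℝ) (C : ℝ≥0∞), 0 ≤ s → s ≤ r → CompBound χ s C → ∀ f : UnitAddCircle → ℂ,
    Continuous f → energy s (fourierCoeff fun x => f (χ x) * v x) ≤
      K * C * energy s (fourierCoeff f)

theorem mulConst_mono {s r : ℝ} (h : s ≤ r) : mulConst s r ≤ mulConst r r := by
  unfold mulConst
  gcongr
  norm_num

theorem HasLiftDeriv.compMulBound (h : HasLiftDeriv χ v) {r : ℝ} {B : ℝ≥0∞}
    (hB : energy r (fourierCoeff fun x => (v x : ℂ)) ≤ B) :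
    CompMulBound χ v r (mulConst r r * B) := by
  intro s C hs hsr hC f hf
  refine (energy_mul_le hs hsr (hf.comp h.continuous)
    (Complex.continuous_ofReal.comp h.continuous_deriv)).trans ?_
  calc _ ≤ mulConst r r * (C * energy s (fourierCoeff f)) * B := by
        gcongr
        · exact mulConst_mono hsr
        · exact hC f (memLp_of_continuous hf 2)
        · exact hB
    _ = _ := by ring

/-- Here `(f ∘ χ) v = (f w) ∘ χ`, so one multiplies before composing. Applied to `χ = φ⁻¹`, whose
derivative is `(1/φ') ∘ φ⁻¹`, this needs an `H^r` bound only for `1/φ'`, not for the derivative of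
the inverse. -/
theorem compMulBound_of_eq_comp {w : UnitAddCircle → ℝ} (hw : Continuous w)
    (hvw : ∀ x, v x = w (χ x)) {r : ℝ} {B : ℝ≥0∞}
    (hB : energy r (fourierCoeff fun x => (w x : ℂ)) ≤ B) :
    CompMulBound χ v r (mulConst r r * B) := by
  intro s C hs hsr hC f hf
  have hw' : Continuous fun x => (w x : ℂ) := Complex.continuous_ofReal.comp hw
  have h1 := hC (fun x => f x * w x) (memLp_of_continuous (hf.mul hw') 2)
  have h2 : (fun x => f x * (w x : ℂ)) ∘ χ = fun x => f (χ x) * v x := by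
    ext x; simp [hvw]
  rw [h2] at h1
  refine h1.trans ?_
  calc _ ≤ C * (mulConst r r * energy s (fourierCoeff f) * B) := by
        gcongr
        refine (energy_mul_le hs hsr hf hw').trans ?_
        gcongr
        exact mulConst_mono hsr
    _ = _ := by ring

end Composition

/-- Composition with `χ` is bounded on `H^s` for `0 ≤ s ≤ r + 1`, with a bound that depends only on
bounds for the derivative of `χ`. -/
theorem exists_compBound {m : ℝ} (hm : 0 < m) (M r : ℝ) {K : ℝ≥0∞}
    (hK : K ≠ ⊤) {s : ℝ} (hs : 0 ≤ s) (hsr : s ≤ r + 1) :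
    ∃ C : ℝ≥0∞, C ≠ ⊤ ∧ ∀ (χ : UnitAddCircle → UnitAddCircle) (v : UnitAddCircle → ℝ),
      HasLiftDeriv χ v → (∀ x, m ≤ v x) → (∀ x, v x ≤ M) → CompMulBound χ v r K →
        CompBound χ s C := by
  have base : ∃ C : ℝ≥0∞, C ≠ ⊤ ∧ ∀ (χ : UnitAddCircle → UnitAddCircle)
      (v : UnitAddCircle → ℝ), HasLiftDeriv χ v → (∀ x, m ≤ v x) → (∀ x, v x ≤ M) →
        ∀ σ, 0 ≤ σ → σ ≤ 1 → CompBound χ σ C := by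
    refine ⟨ENNReal.ofReal m⁻¹ + ENNReal.ofReal M ^ 2 * ENNReal.ofReal m⁻¹ * derivConst,
      ENNReal.add_ne_top.2 ⟨ENNReal.ofReal_ne_top, ENNReal.mul_ne_top (by finiteness)
        derivConst_ne_top⟩, fun χ v h hv hM σ hσ0 hσ1 => ?_⟩
    have h0 := h.compBound_zero hm hv
    refine h.compBound_interpolate hm hv (ENNReal.add_ne_top.2 ⟨ENNReal.ofReal_ne_top,
      ENNReal.mul_ne_top (by finiteness) derivConst_ne_top⟩) (h0.mono le_self_add) ?_ hσ0 hσ1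
    -- At the level `s = 0` the factor `v` costs only its supremum `M`, squared.
    have h1 := h.compBound_succ hm hv h0 (D := ENNReal.ofReal M ^ 2 * ENNReal.ofReal m⁻¹) ?_
    · rwa [zero_add] at h1
    intro f hf
    have hfv : Continuous fun x => f (χ x) * (v x : ℂ) :=
      (hf.comp h.continuous).mul (Complex.continuous_ofReal.comp h.continuous_deriv)
    refine le_trans ?_ ((mul_le_mul_right (h0 f (memLp_of_continuous hf 2))
      (ENNReal.ofReal M ^ 2)).trans_eq (mul_assoc _ _ _).symm)
    rw [energy_zero_fourierCoeff (memLp_of_continuous hfv 2),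
      energy_zero_fourierCoeff (memLp_of_continuous (hf.comp h.continuous) 2),
      ← lintegral_const_mul' _ _ (by finiteness)]
    refine lintegral_mono fun x => ?_
    rw [enorm_mul, mul_pow, mul_comm]
    gcongr
    · rw [← ofReal_norm, Complex.norm_real, Real.norm_of_nonneg (hm.le.trans (hv x))]
      exact ENNReal.ofReal_le_ofReal (hM x)
    · rfl
  -- Unit steps starting from the whole interval `[0, 1]`, which is how non-integer exponents are
  -- reached. A step goes from `s - 1` to `s`, and `s - 1 ≤ r` is what the multiplier bound allows.
  have main : ∀ (n : ℕ) (s : ℝ), 0 ≤ s → s ≤ r + 1 → s ≤ n + 1 → ∃ C : ℝ≥0∞, C ≠ ⊤ ∧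
      ∀ (χ : UnitAddCircle → UnitAddCircle) (v : UnitAddCircle → ℝ), HasLiftDeriv χ v →
        (∀ x, m ≤ v x) → (∀ x, v x ≤ M) → CompMulBound χ v r K → CompBound χ s C := by
    obtain ⟨C₀, hC₀, hb⟩ := base
    intro n
    induction n with
    | zero =>
      intro s hs _ hs1
      exact ⟨C₀, hC₀, fun χ v h hv hM _ => hb χ v h hv hM s hs (by simpa using hs1)⟩
    | succ n ih =>
      intro s hs hsr hsn
      rcases le_total s 1 with hs1 | hs1
      · exact ⟨C₀, hC₀, fun χ v h hv hM _ => hb χ v h hv hM s hs hs1⟩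
      push_cast at hsn
      obtain ⟨C, hC, hCb⟩ := ih (s - 1) (by linarith) (by linarith) (by linarith)
      refine ⟨C + K * C * derivConst, ENNReal.add_ne_top.2 ⟨hC, ENNReal.mul_ne_top
        (ENNReal.mul_ne_top hK hC) derivConst_ne_top⟩, fun χ v h hv hM hKb => ?_⟩
      have h1 := hCb χ v h hv hM hKb
      have h2 := h.compBound_succ hm hv h1 (hKb _ _ (by linarith) (by linarith) h1)
      rwa [sub_add_cancel] at h2
  obtain ⟨n, hn⟩ := exists_nat_ge s
  exact main n s hs hsr (by linarith)

/-! ### Sobolev norms as energies, and the derivative data of a diffeomorphism -/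

theorem energy_coeff {𝕜 : Type*} [RCLike 𝕜] {s : ℝ} (u : Space 𝕜 s) :
    energy s (coeff u.toL2) = ENNReal.ofReal (‖u‖ ^ 2) := by
  have hsum : Summable fun k : ℤ => (1 + (k : ℝ) ^ 2) ^ s * ‖coeff u.toL2 k‖ ^ 2 := u.2
  rw [Space.norm_eq, Real.sq_sqrt (tsum_nonneg fun k => by positivity),
    ENNReal.ofReal_tsum_of_nonneg (fun k => by positivity) hsum]
  refine tsum_congr fun k => ?_
  rw [ENNReal.ofReal_mul (by positivity), wt_rpow_eq_ofReal, enorm_sq_eq_ofReal]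

theorem coeff_eq_of_ae {𝕜 : Type*} [RCLike 𝕜] {u : L2 𝕜} {f : UnitAddCircle → 𝕜}
    (h : u =ᵐ[AddCircle.haarAddCircle] f) :
    coeff u = fourierCoeff fun x => RCLike.map 𝕜 ℂ (f x) := by
  refine fourierCoeff_congr_ae ?_
  filter_upwards [h] with x hx
  rw [hx]

theorem map_real_complex (x : ℝ) : RCLike.map ℝ ℂ x = (x : ℂ) := by
  simp

theorem IsDeriv.unique {f f₁ f₂ : UnitAddCircle → ℂ} (h₁ : IsDeriv f f₁) (h₂ : IsDeriv f f₂) :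
    f₁ = f₂ := by
  ext x
  obtain ⟨t, rfl⟩ := QuotientAddGroup.mk_surjective x
  exact (h₁.2 t).unique (h₂.2 t)

theorem IsDeriv.sub {f f' g g' : UnitAddCircle → ℂ} (hf : IsDeriv f f') (hg : IsDeriv g g') :
    IsDeriv (f - g) (f' - g') :=
  ⟨hf.1.sub hg.1, fun x => (hf.2 x).sub (hg.2 x)⟩

theorem isDeriv_fourier (n : ℤ) :
    IsDeriv (fun x => fourier n x) fun x => 2 * Real.pi * Complex.I * n * fourier n x := by
  refine ⟨continuous_const.mul (map_continuous (fourier n)), fun x => ?_⟩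
  exact (hasDerivAt_fourier 1 n x).congr_deriv (by push_cast; ring)

theorem fourier_ne_zero (n : ℤ) (x : UnitAddCircle) : (fourier n x : ℂ) ≠ 0 := by
  rw [fourier_apply]
  exact Circle.coe_ne_zero _

theorem energy_fourierCoeff_fourier_ne_top (s : ℝ) (n : ℤ) :
    energy s (fourierCoeff fun x : UnitAddCircle => (fourier n x : ℂ)) ≠ ⊤ := by
  have h := fourierCoeff_fourier (T := 1) n
  rw [energy, tsum_eq_single n]
  · rw [show (fun x : UnitAddCircle => (fourier n x : ℂ)) = fourier n from rfl, h]
    simp [wt_ne_zero, wt_ne_top]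
  · intro k hk
    rw [show (fun x : UnitAddCircle => (fourier n x : ℂ)) = fourier n from rfl, h]
    simp [hk]

theorem energy_fourierCoeff_one_ne_top (s : ℝ) :
    energy s (fourierCoeff fun _ : UnitAddCircle => (1 : ℂ)) ≠ ⊤ := by
  simpa only [fourier_zero] using energy_fourierCoeff_fourier_ne_top s 0

theorem energy_fourierCoeff_add_le (s : ℝ) {f g : UnitAddCircle → ℂ} (hf : Continuous f)
    (hg : Continuous g) : energy s (fourierCoeff (f + g)) ≤
      2 * (energy s (fourierCoeff f) + energy s (fourierCoeff g)) := by
  rw [fourierCoeff.add (integrable_of_memLp (memLp_of_continuous hf 2))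
    (integrable_of_memLp (memLp_of_continuous hg 2))]
  exact energy_add_le s _ _

/-- The displacement `d` of a circle map and the derivative `v` of its lift. -/
theorem IsDisplacement.exists_deriv {q : ℝ} {φ : UnitAddCircle → UnitAddCircle} {g : Space ℝ q}
    (h : IsDisplacement φ g) : ∃ (d : C(UnitAddCircle, ℝ)) (v : UnitAddCircle → ℝ),
      (∀ x : UnitAddCircle, φ x = x + ((d x : ℝ) : UnitAddCircle)) ∧
      (g : UnitAddCircle → ℝ) =ᵐ[AddCircle.haarAddCircle] d ∧ HasLiftDeriv φ v ∧
      IsDeriv (fun x => (d x : ℂ)) (fun x => (v x : ℂ) - 1) ∧ ∀ x, 0 ≤ v x := by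
  obtain ⟨d, hφ, hmono, hC, hg⟩ := h
  set X : ℝ → ℝ := fun x : ℝ => x + d (x : UnitAddCircle) with hX
  have hdiff : Differentiable ℝ X := hC.differentiable (by norm_num)
  have hXp : ∀ t, X (t + 1) = X t + 1 := fun t => by
    simp only [hX, AddCircle.coe_add, AddCircle.coe_period, add_zero]
    ring
  have hper : Function.Periodic (deriv X) 1 := fun t => by
    rw [← deriv_comp_add_const]
    simp_rw [hXp]
    rw [deriv_add_const]
  have hv : Continuous hper.lift :=
    continuous_of_continuous_comp_coe (by
      simp only [Function.Periodic.lift_coe]; exact hC.continuous_deriv le_rfl)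
  have hd : ∀ t : ℝ, HasDerivAt X (hper.lift (t : UnitAddCircle)) t := fun t => by
    rw [Function.Periodic.lift_coe]; exact (hdiff t).hasDerivAt
  refine ⟨d, hper.lift, hφ, hg, ⟨hv, X, fun t => ?_, hd, ?_⟩, ⟨?_, fun x => ?_⟩, fun x => ?_⟩
  · rw [hφ]; rfl
  · simpa using hXp 0
  · exact (Complex.continuous_ofReal.comp hv).sub continuous_const
  · have h1 := ((hd x).sub (hasDerivAt_id x)).ofReal_comp
    push_cast at h1
    refine h1.congr_of_eventuallyEq (Eventually.of_forall fun t => ?_)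
    simp [hX]
  · obtain ⟨t, rfl⟩ := QuotientAddGroup.mk_surjective x
    rw [Function.Periodic.lift_coe]
    exact hmono.monotone.deriv_nonneg

/-- The displacement `d` of `φ`, the derivative `v` of `φ`, and its reciprocal `w`, with the
regularity that they have for `φ ∈ D^q`. -/
structure IsLiftData {q : ℝ} (φ : Diffeo q) (g : Space ℝ q) (d : C(UnitAddCircle, ℝ))
    (v w : UnitAddCircle → ℝ) : Prop where
  apply_eq : ∀ x : UnitAddCircle, φ x = x + ((d x : ℝ) : UnitAddCircle)
  ae_eq : (g : UnitAddCircle → ℝ) =ᵐ[AddCircle.haarAddCircle] d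
  hasLiftDeriv : HasLiftDeriv φ v
  hasLiftDeriv_inv : HasLiftDeriv (φ⁻¹ : Diffeo q) fun x => w ((φ⁻¹ : Diffeo q) x)
  isDeriv : IsDeriv (fun x => (d x : ℂ)) (fun x => (v x : ℂ) - 1)
  continuous_recip : Continuous w
  pos : ∀ x, 0 < v x
  mul_eq_one : ∀ x, v x * w x = 1
  energy_deriv_ne_top : energy (q - 1) (fourierCoeff fun x => (v x : ℂ)) ≠ ⊤
  energy_recip_ne_top : energy (q - 1) (fourierCoeff fun x => (w x : ℂ)) ≠ ⊤

theorem energy_deriv_ne_top_of_ae {q : ℝ} {g : Space ℝ q} {d : C(UnitAddCircle, ℝ)}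
    {v : UnitAddCircle → ℝ} (hg : (g : UnitAddCircle → ℝ) =ᵐ[AddCircle.haarAddCircle] d)
    (hd : IsDeriv (fun x => (d x : ℂ)) (fun x => (v x : ℂ) - 1)) :
    energy (q - 1) (fourierCoeff fun x => (v x : ℂ)) ≠ ⊤ := by
  have h1 := hd.energy_le (q - 1)
  have h2 := coeff_eq_of_ae hg
  simp only [map_real_complex] at h2
  rw [sub_add_cancel, ← h2, energy_coeff] at h1
  have h3 := energy_fourierCoeff_add_le (q - 1) hd.1 (continuous_const (y := (1 : ℂ)))
  have h4 : (fun x => (v x : ℂ) - 1) + (fun _ => 1) = fun x => (v x : ℂ) := by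
    ext x; simp
  rw [h4] at h3
  refine ne_top_of_le_ne_top ?_ h3
  refine ENNReal.mul_ne_top (by norm_num) (ENNReal.add_ne_top.2 ⟨?_,
    energy_fourierCoeff_one_ne_top _⟩)
  exact ne_top_of_le_ne_top (ENNReal.mul_ne_top derivConst_ne_top ENNReal.ofReal_ne_top) h1

theorem exists_pos_forall_le_of_continuous {v : UnitAddCircle → ℝ} (hv : Continuous v)
    (hpos : ∀ x, 0 < v x) : ∃ m M, 0 < m ∧ ∀ x, m ≤ v x ∧ v x ≤ M := by
  obtain ⟨x₀, -, h₀⟩ := isCompact_univ.exists_isMinOn Set.univ_nonempty hv.continuousOn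
  obtain ⟨x₁, -, h₁⟩ := isCompact_univ.exists_isMaxOn Set.univ_nonempty hv.continuousOn
  exact ⟨v x₀, v x₁, hpos x₀, fun x => ⟨h₀ (Set.mem_univ x), h₁ (Set.mem_univ x)⟩⟩

theorem Diffeo.inv_apply_apply {q : ℝ} (φ : Diffeo q) (x : UnitAddCircle) :
    (φ⁻¹ : Diffeo q) (φ x) = x := φ.toHomeomorph.symm_apply_apply x

theorem Diffeo.apply_inv_apply {q : ℝ} (φ : Diffeo q) (x : UnitAddCircle) :
    φ ((φ⁻¹ : Diffeo q) x) = x := φ.toHomeomorph.apply_symm_apply x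

/-- The reciprocal of `φ'` is `w = (φ⁻¹)' ∘ φ`. Its `H^{q-1}` regularity comes from that of `(φ⁻¹)'`
and the boundedness of composition with `φ`, which uses only `φ'`, so the argument is not circular.
-/
theorem IsDisplacement.exists_isLiftData {q : ℝ} (hq : 3 / 2 < q) {φ : Diffeo q} {g : Space ℝ q}
    (h : IsDisplacement φ g) : ∃ d v w, IsLiftData φ g d v w := by
  obtain ⟨d, v, hφ, hg, hL, hD, hv0⟩ := h.exists_deriv
  obtain ⟨g₂, hg₂⟩ := φ.exists_displacement_symm
  obtain ⟨d₂, v₂, -, hg₂, hL₂, hD₂, -⟩ := hg₂.exists_deriv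
  have hL₂' : HasLiftDeriv (φ⁻¹ : Diffeo q) v₂ := hL₂
  -- Circle maps are differentiated by testing against `e_1`: the identity `e_1 ∘ φ⁻¹ ∘ φ = e_1` is
  -- differentiated and the nonvanishing `e_1'` cancelled.
  have hvw : ∀ x, v x * v₂ (φ x) = 1 := by
    intro x
    have h1 := ((isDeriv_fourier 1).comp hL₂').comp hL
    have h2 : ((fun x : UnitAddCircle => (fourier 1 x : ℂ)) ∘ (φ⁻¹ : Diffeo q)) ∘ φ =
        fun x => (fourier 1 x : ℂ) := by
      ext x
      simp only [Function.comp_apply, Diffeo.inv_apply_apply]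
    rw [h2] at h1
    have h3 := congrFun (h1.unique (isDeriv_fourier 1)) x
    simp only [Diffeo.inv_apply_apply] at h3
    have h4 : (2 * Real.pi * Complex.I * (1 : ℤ) * fourier 1 x : ℂ) ≠ 0 :=
      mul_ne_zero (by simp [Real.pi_ne_zero]) (fourier_ne_zero 1 x)
    rw [mul_assoc] at h3
    have h5 := mul_left_cancel₀ h4 (h3.trans (mul_one _).symm)
    rw [mul_comm]
    exact_mod_cast h5
  -- Monotonicity of the lift gives only `0 ≤ v`; differentiability of the inverse excludes zeros.
  have hpos : ∀ x, 0 < v x := fun x => (hv0 x).lt_of_ne fun h0 => by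
    have := hvw x
    rw [← h0, zero_mul] at this
    exact zero_ne_one this
  refine ⟨d, v, fun x => v₂ (φ x), hφ, hg, hL, ?_, hD, hL₂.continuous_deriv.comp hL.continuous,
    hpos, hvw, energy_deriv_ne_top_of_ae hg hD, ?_⟩
  · simpa only [Diffeo.apply_inv_apply] using hL₂'
  · obtain ⟨m, M, hm, hmM⟩ := exists_pos_forall_le_of_continuous hL.continuous_deriv hpos
    obtain ⟨C, hC, hCb⟩ := exists_compBound hm M (q - 1)
      (ENNReal.mul_ne_top (mulConst_ne_top (s := q - 1) (r := q - 1) (by linarith))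
        (energy_deriv_ne_top_of_ae hg hD)) (s := q - 1) (by linarith) (by linarith)
    have hb := hCb φ v hL (fun x => (hmM x).1) (fun x => (hmM x).2) (hL.compMulBound le_rfl)
    have := hb (fun x => (v₂ x : ℂ))
      (memLp_of_continuous (Complex.continuous_ofReal.comp hL₂.continuous_deriv) 2)
    exact ne_top_of_le_ne_top (ENNReal.mul_ne_top hC (energy_deriv_ne_top_of_ae hg₂ hD₂)) this

/-! ### Uniform bounds near a given diffeomorphism -/

section Differences

variable {q : ℝ} {φ φ₀ : Diffeo q} {g g₀ : Space ℝ q} {d d₀ : C(UnitAddCircle, ℝ)}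
  {v w v₀ w₀ : UnitAddCircle → ℝ}

theorem IsLiftData.isDeriv_sub (h : IsLiftData φ g d v w) (h₀ : IsLiftData φ₀ g₀ d₀ v₀ w₀) :
    IsDeriv (fun x => ((d x - d₀ x : ℝ) : ℂ)) (fun x => ((v x - v₀ x : ℝ) : ℂ)) := by
  convert h.isDeriv.sub h₀.isDeriv using 1 <;> ext x <;> simp

theorem IsLiftData.energy_sub (h : IsLiftData φ g d v w) (h₀ : IsLiftData φ₀ g₀ d₀ v₀ w₀) :
    energy q (fourierCoeff fun x => ((d x - d₀ x : ℝ) : ℂ)) = ENNReal.ofReal (‖g - g₀‖ ^ 2) := by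
  have h1 : ((g - g₀ : Space ℝ q) : UnitAddCircle → ℝ) =ᵐ[AddCircle.haarAddCircle]
      fun x => d x - d₀ x := by
    have h2 : (g - g₀).toL2 = g.toL2 - g₀.toL2 := rfl
    rw [h2]
    filter_upwards [Lp.coeFn_sub g.toL2 g₀.toL2, h.ae_eq, h₀.ae_eq] with x hx hx1 hx2
    rw [hx, Pi.sub_apply, hx1, hx2]
  rw [← energy_coeff, coeff_eq_of_ae h1]
  simp only [map_real_complex]

theorem IsLiftData.energy_deriv_sub_le (h : IsLiftData φ g d v w)
    (h₀ : IsLiftData φ₀ g₀ d₀ v₀ w₀) :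
    energy (q - 1) (fourierCoeff fun x => ((v x - v₀ x : ℝ) : ℂ)) ≤
      derivConst * ENNReal.ofReal (‖g - g₀‖ ^ 2) := by
  have := (h.isDeriv_sub h₀).energy_le (q - 1)
  rwa [sub_add_cancel, h.energy_sub h₀] at this

theorem exists_pos_mul_sq_le {K ε : ℝ≥0∞} (hK : K ≠ ⊤) (hε : ε ≠ 0) :
    ∃ δ : ℝ, 0 < δ ∧ ∀ x : ℝ, 0 ≤ x → x < δ → K * ENNReal.ofReal (x ^ 2) ≤ ε := by
  have h1 : Tendsto (fun x : ℝ => K * ENNReal.ofReal (x ^ 2)) (𝓝 0) (𝓝 0) := by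
    have : Continuous fun x : ℝ => K * ENNReal.ofReal (x ^ 2) :=
      (ENNReal.continuous_const_mul hK).comp (ENNReal.continuous_ofReal.comp (continuous_pow 2))
    simpa using this.tendsto 0
  obtain ⟨δ, hδ, h⟩ := Metric.eventually_nhds_iff.1 (h1.eventually_le_const (pos_iff_ne_zero.2 hε))
  refine ⟨δ, hδ, fun x hx0 hx => h ?_⟩
  rwa [Real.dist_eq, sub_zero, abs_of_nonneg hx0]

/-- Uniform bounds near a given diffeomorphism. -/
theorem IsLiftData.exists_local_bounds (hq : 3 / 2 < q) (h₀ : IsLiftData φ₀ g₀ d₀ v₀ w₀) :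
    ∃ (δ m M : ℝ) (B : ℝ≥0∞), 0 < δ ∧ 0 < m ∧ 0 < M ∧ B ≠ ⊤ ∧
      ∀ (φ : Diffeo q) (g : Space ℝ q) (d : C(UnitAddCircle, ℝ)) (v w : UnitAddCircle → ℝ),
        IsLiftData φ g d v w → ‖g - g₀‖ < δ → (∀ x, m ≤ v x) ∧ (∀ x, v x ≤ M) ∧
          energy (q - 1) (fourierCoeff fun x => (v x : ℂ)) ≤ B ∧
          energy (q - 1) (fourierCoeff fun x => (w x : ℂ)) ≤ B := by
  have hr : 1 / 2 < q - 1 := by linarith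
  have hr0 : 0 ≤ q - 1 := by linarith
  obtain ⟨m, M, hm, hmM⟩ :=
    exists_pos_forall_le_of_continuous h₀.hasLiftDeriv.continuous_deriv h₀.pos
  have hM : 0 < M := hm.trans_le ((hmM 0).1.trans (hmM 0).2)
  set W₀ := energy (q - 1) (fourierCoeff fun x => (w₀ x : ℂ)) with hW₀
  set V₀ := energy (q - 1) (fourierCoeff fun x => (v₀ x : ℂ)) with hV₀
  have hW₀t : W₀ ≠ ⊤ := h₀.energy_recip_ne_top
  have hV₀t : V₀ ≠ ⊤ := h₀.energy_deriv_ne_top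
  set c := mulConst (q - 1) (q - 1) with hc
  have hct : c ≠ ⊤ := mulConst_ne_top hr
  -- The three radii ensure, in turn: `|v - v₀| ≤ m/2` everywhere, a coefficient at most `1/2` in
  -- the absorption argument for `w`, and energy at most `1` for `v - v₀`.
  obtain ⟨δ₁, hδ₁, h1⟩ := exists_pos_mul_sq_le (K := embConst (q - 1) * derivConst)
    (ε := ENNReal.ofReal ((m / 2) ^ 2)) (ENNReal.mul_ne_top (embConst_ne_top hr) derivConst_ne_top)
    (by simpa using by positivity)
  obtain ⟨δ₂, hδ₂, h2⟩ := exists_pos_mul_sq_le (K := 2 * (c * (c * W₀ * derivConst)))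
    (ε := 2⁻¹) (by have := derivConst_ne_top; finiteness) (by norm_num)
  obtain ⟨δ₃, hδ₃, h3⟩ := exists_pos_mul_sq_le (K := derivConst) (ε := 1)
    derivConst_ne_top (by norm_num)
  refine ⟨min δ₁ (min δ₂ δ₃), m / 2, M + m / 2, 2 * (1 + V₀) + 2 * (2 * W₀), by positivity,
    by positivity, by positivity, by finiteness, fun φ g d v w h hg => ?_⟩
  have hE := h.energy_deriv_sub_le h₀
  set E := energy (q - 1) (fourierCoeff fun x => ((v x - v₀ x : ℝ) : ℂ)) with hEdef
  have hvc := h.hasLiftDeriv.continuous_deriv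
  have hv₀c := h₀.hasLiftDeriv.continuous_deriv
  have hsubc : Continuous fun x => ((v x - v₀ x : ℝ) : ℂ) :=
    Complex.continuous_ofReal.comp (hvc.sub hv₀c)
  have g1 := h1 _ (norm_nonneg _) (hg.trans_le (min_le_left _ _))
  have g2 := h2 _ (norm_nonneg _) (hg.trans_le ((min_le_right _ _).trans (min_le_left _ _)))
  have g3 := h3 _ (norm_nonneg _) (hg.trans_le ((min_le_right _ _).trans (min_le_right _ _)))
  have hsup : ∀ x, |v x - v₀ x| ≤ m / 2 := by
    intro x
    have h4 := (sq_enorm_le_embConst_mul hr hsubc x).trans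
      ((mul_le_mul_right hE _).trans ((mul_assoc _ _ _).symm.le.trans g1))
    rw [enorm_sq_eq_ofReal, ENNReal.ofReal_le_ofReal_iff (by positivity), Complex.norm_real,
      Real.norm_eq_abs] at h4
    exact (pow_le_pow_iff_left₀ (abs_nonneg _) (by positivity) two_ne_zero).1 h4
  refine ⟨fun x => ?_, fun x => ?_, ?_, ?_⟩
  · linarith [(abs_le.1 (hsup x)).1, (hmM x).1]
  · linarith [(abs_le.1 (hsup x)).2, (hmM x).2]
  · refine le_trans ?_ le_self_add
    have h5 : (fun x => (v x : ℂ)) = (fun x => ((v x - v₀ x : ℝ) : ℂ)) + fun x => (v₀ x : ℂ) := by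
      ext x; simp
    rw [h5]
    refine (energy_fourierCoeff_add_le _ hsubc (Complex.continuous_ofReal.comp hv₀c)).trans ?_
    gcongr
    · exact hE.trans g3
    · rfl
  · refine le_trans ?_ le_add_self
    have hwc : Continuous fun x => (w x : ℂ) := Complex.continuous_ofReal.comp h.continuous_recip
    have hw₀c : Continuous fun x => (w₀ x : ℂ) :=
      Complex.continuous_ofReal.comp h₀.continuous_recip
    -- The resolvent identity `w = w₀ - w w₀ (v - v₀)` for reciprocals.
    have h6 : (fun x => (w x : ℂ)) = (fun x => (w₀ x : ℂ)) +
        fun x => (-1 : ℂ) * ((w x : ℂ) * ((w₀ x : ℂ) * ((v x - v₀ x : ℝ) : ℂ))) := by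
      ext x
      have e1 := h.mul_eq_one x
      have e2 := h₀.mul_eq_one x
      have : w x = w₀ x + -1 * (w x * (w₀ x * (v x - v₀ x))) := by
        linear_combination w₀ x * e1 - w x * e2
      simp only [Pi.add_apply]
      exact_mod_cast this
    set W := energy (q - 1) (fourierCoeff fun x => (w x : ℂ)) with hW
    have hWt : W ≠ ⊤ := h.energy_recip_ne_top
    have h7 : W ≤ 2 * (W₀ + W * (c * (c * W₀ * E))) := by
      have hpc : Continuous fun x => (-1 : ℂ) * ((w x : ℂ) * ((w₀ x : ℂ) *
          ((v x - v₀ x : ℝ) : ℂ))) := continuous_const.mul (hwc.mul (hw₀c.mul hsubc))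
      have h7a := energy_fourierCoeff_add_le (q - 1) hw₀c hpc
      rw [← h6] at h7a
      refine h7a.trans ?_
      gcongr
      have h8 : fourierCoeff (fun x => (-1 : ℂ) * ((w x : ℂ) * ((w₀ x : ℂ) *
          ((v x - v₀ x : ℝ) : ℂ)))) = fun k => (-1) * fourierCoeff (fun x => (w x : ℂ) *
            ((w₀ x : ℂ) * ((v x - v₀ x : ℝ) : ℂ))) k := by
        ext k
        exact fourierCoeff.const_mul _ _ _
      rw [h8, energy_const_mul]
      simp only [enorm_neg, enorm_one, one_pow, one_mul]
      refine (energy_mul_le hr0 le_rfl hwc (hw₀c.mul hsubc)).trans ?_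
      rw [mul_comm c, mul_assoc]
      change W * (c * _) ≤ _
      gcongr
      exact energy_mul_le hr0 le_rfl hw₀c hsubc
    -- The term `W/2` can be absorbed on the left because `W` is already known to be finite; this
    -- gives `W ≤ 4 W₀`.
    have h9 : W ≤ 2 * W₀ + 2⁻¹ * W := by
      refine h7.trans ?_
      rw [mul_add]
      refine add_le_add le_rfl ?_
      calc 2 * (W * (c * (c * W₀ * E)))
          ≤ 2 * (W * (c * (c * W₀ * (derivConst * ENNReal.ofReal (‖g - g₀‖ ^ 2))))) := by gcongr
        _ = (2 * (c * (c * W₀ * derivConst)) * ENNReal.ofReal (‖g - g₀‖ ^ 2)) * W := by ring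
        _ ≤ 2⁻¹ * W := by gcongr
    have h10 : 2⁻¹ * W ≤ 2 * W₀ := by
      have h11 : W = 2⁻¹ * W + 2⁻¹ * W := by
        rw [← add_mul, ENNReal.inv_two_add_inv_two, one_mul]
      refine (ENNReal.add_le_add_iff_right (a := 2⁻¹ * W) (by finiteness)).1 ?_
      rw [← h11]
      exact h9
    calc W = 2 * (2⁻¹ * W) := by
          rw [← mul_assoc, ENNReal.mul_inv_cancel (by norm_num) (by norm_num), one_mul]
      _ ≤ 2 * (2 * W₀) := by gcongr

end Differences

/-! ### Local bounds for composition, and Lipschitz dependence of `e_n ∘ φ` on `φ` -/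

theorem norm_fourier_sub_le (n : ℤ) (a b : ℝ) :
    ‖(fourier n (a : UnitAddCircle) : ℂ) - fourier n (b : UnitAddCircle)‖ ≤
      ‖(2 * Real.pi * Complex.I * n : ℂ)‖ * |a - b| := by
  refine Convex.norm_image_sub_le_of_norm_hasDerivWithin_le (s := Set.univ)
    (f := fun t : ℝ => (fourier n (t : UnitAddCircle) : ℂ))
    (fun t _ => ((isDeriv_fourier n).2 t).hasDerivWithinAt) (fun t _ => ?_) convex_univ
    (Set.mem_univ b) (Set.mem_univ a)
  rw [norm_mul, fourier_apply, Circle.norm_coe, mul_one]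

section Local

variable {q : ℝ} {φ₀ : Diffeo q} {g₀ : Space ℝ q} {d₀ : C(UnitAddCircle, ℝ)}
  {v₀ w₀ : UnitAddCircle → ℝ}

/-- Composition with `φ` and `φ⁻¹` is bounded on `H^s`, `0 ≤ s ≤ q`, uniformly near a given
diffeomorphism. -/
theorem IsLiftData.exists_local_compBound (hq : 3 / 2 < q) (h₀ : IsLiftData φ₀ g₀ d₀ v₀ w₀)
    {s : ℝ} (hs : 0 ≤ s) (hsq : s ≤ q) : ∃ (δ : ℝ) (C : ℝ≥0∞), 0 < δ ∧ C ≠ ⊤ ∧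
      ∀ (φ : Diffeo q) (g : Space ℝ q), IsDisplacement φ g → ‖g - g₀‖ < δ →
        CompBound φ s C ∧ CompBound (φ⁻¹ : Diffeo q) s C := by
  obtain ⟨δ, m, M, B, hδ, hm, hM, hB, hb⟩ := h₀.exists_local_bounds hq
  have hK : mulConst (q - 1) (q - 1) * B ≠ ⊤ :=
    ENNReal.mul_ne_top (mulConst_ne_top (by linarith)) hB
  obtain ⟨C₁, hC₁, h1⟩ := exists_compBound hm M (q - 1) hK hs (by linarith)
  -- The derivative of `φ⁻¹` takes the values `1/v`, which lie between `M⁻¹` and `m⁻¹`.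
  obtain ⟨C₂, hC₂, h2⟩ := exists_compBound (inv_pos.2 hM) m⁻¹ (q - 1) hK hs (by linarith)
  refine ⟨δ, C₁ + C₂, hδ, ENNReal.add_ne_top.2 ⟨hC₁, hC₂⟩, fun φ g hφ hg => ?_⟩
  obtain ⟨d, v, w, h⟩ := hφ.exists_isLiftData hq
  obtain ⟨hv, hvM, hBv, hBw⟩ := hb φ g d v w h hg
  have hw : ∀ x, w x = (v x)⁻¹ := fun x => eq_inv_of_mul_eq_one_right (h.mul_eq_one x)
  refine ⟨(h1 φ v h.hasLiftDeriv hv hvM (h.hasLiftDeriv.compMulBound hBv)).mono le_self_add,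
    (h2 _ _ h.hasLiftDeriv_inv (fun x => ?_) (fun x => ?_) (compMulBound_of_eq_comp
      h.continuous_recip (fun x => rfl) hBw)).mono le_add_self⟩
  · rw [hw]
    exact inv_anti₀ (h.pos _) (hvM _)
  · rw [hw]
    exact inv_anti₀ hm (hv _)

/-- The derivative is arranged so that each term has a small factor: the original difference,
multiplied by `v`, or `v - v₀`. This form closes the induction on the regularity. -/
theorem IsLiftData.isDeriv_fourier_comp_sub {φ : Diffeo q} {g : Space ℝ q}
    {d : C(UnitAddCircle, ℝ)} {v w : UnitAddCircle → ℝ} (h : IsLiftData φ g d v w)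
    (h₀ : IsLiftData φ₀ g₀ d₀ v₀ w₀) (n : ℤ) :
    IsDeriv (fun x => (fourier n (φ x) : ℂ) - fourier n (φ₀ x)) fun x =>
      (2 * Real.pi * Complex.I * n) * (((fourier n (φ x) : ℂ) - fourier n (φ₀ x)) * v x +
        fourier n (φ₀ x) * ((v x - v₀ x : ℝ) : ℂ)) := by
  have key := ((isDeriv_fourier n).comp h.hasLiftDeriv).sub
    ((isDeriv_fourier n).comp h₀.hasLiftDeriv)
  convert! key using 1
  ext x
  simp only [Pi.sub_apply]
  push_cast
  ring

/-- `e_n` is Lipschitz on lifts, and the Sobolev embedding bounds `|d - d₀|` by `‖g - g₀‖`. -/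
theorem IsLiftData.sq_enorm_fourier_comp_sub_le {φ : Diffeo q} {g : Space ℝ q}
    {d : C(UnitAddCircle, ℝ)} {v w : UnitAddCircle → ℝ} (hq : 1 / 2 < q)
    (h : IsLiftData φ g d v w) (h₀ : IsLiftData φ₀ g₀ d₀ v₀ w₀) (n : ℤ) (x : UnitAddCircle) :
    ‖(fourier n (φ x) : ℂ) - fourier n (φ₀ x)‖ₑ ^ 2 ≤
      ‖(2 * Real.pi * Complex.I * n : ℂ)‖ₑ ^ 2 * embConst q * ENNReal.ofReal (‖g - g₀‖ ^ 2) := by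
  have h1 := sq_enorm_le_embConst_mul hq (h.isDeriv_sub h₀).continuous x
  rw [h.energy_sub h₀] at h1
  rw [mul_assoc]
  refine le_trans ?_ (mul_le_mul_right h1 _)
  rw [← mul_pow, ← enorm_mul]
  gcongr
  rw [← ofReal_norm, ← ofReal_norm]
  refine ENNReal.ofReal_le_ofReal ?_
  obtain ⟨t, rfl⟩ := QuotientAddGroup.mk_surjective x
  rw [h.apply_eq, h₀.apply_eq, norm_mul, Complex.norm_real, Real.norm_eq_abs]
  refine (norm_fourier_sub_le n (t + d (t : UnitAddCircle))
    (t + d₀ (t : UnitAddCircle))).trans (le_of_eq ?_)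
  rw [add_sub_add_left_eq_sub]

theorem fourierCoeff_const_mul (c : ℂ) (f : UnitAddCircle → ℂ) :
    fourierCoeff (fun x => c * f x) = fun k => c * fourierCoeff f k :=
  funext fun _ => fourierCoeff.const_mul _ _ _

/-- The map `φ ↦ e_n ∘ φ` is locally Lipschitz at `φ₀` as a map into `H^s`, `0 ≤ s ≤ q`. -/
theorem IsLiftData.exists_energy_fourier_comp_sub_le (hq : 3 / 2 < q)
    (h₀ : IsLiftData φ₀ g₀ d₀ v₀ w₀) (n : ℤ) {s : ℝ} (hs : 0 ≤ s) (hsq : s ≤ q) :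
    ∃ (δ : ℝ) (C : ℝ≥0∞), 0 < δ ∧ C ≠ ⊤ ∧ ∀ (φ : Diffeo q) (g : Space ℝ q),
      IsDisplacement φ g → ‖g - g₀‖ < δ →
        energy s (fourierCoeff fun x => (fourier n (φ x) : ℂ) - fourier n (φ₀ x)) ≤
          C * ENNReal.ofReal (‖g - g₀‖ ^ 2) := by
  obtain ⟨δ, _, _, B, hδ, _, _, hB, hb⟩ := h₀.exists_local_bounds hq
  have hr : 1 / 2 < q - 1 := by linarith
  set c : ℂ := 2 * Real.pi * Complex.I * n with hc
  let P : ℝ → Prop := fun s => ∃ C : ℝ≥0∞, C ≠ ⊤ ∧ ∀ (φ : Diffeo q) (g : Space ℝ q)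
    (d : C(UnitAddCircle, ℝ)) (v w : UnitAddCircle → ℝ), IsLiftData φ g d v w → ‖g - g₀‖ < δ →
      energy s (fourierCoeff fun x => (fourier n (φ x) : ℂ) - fourier n (φ₀ x)) ≤
        C * ENNReal.ofReal (‖g - g₀‖ ^ 2)
  have hmono : ∀ s t, s ≤ t → P t → P s := fun s t hst ⟨C, hC, h⟩ =>
    ⟨C, hC, fun φ g d v w hd hg => (energy_mono hst _).trans (h φ g d v w hd hg)⟩
  have hzero : P 0 := ⟨‖c‖ₑ ^ 2 * embConst q,
    ENNReal.mul_ne_top (by finiteness) (embConst_ne_top (by linarith)), fun φ g d v w hd hg =>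
      energy_zero_le_of_bound (hd.isDeriv_fourier_comp_sub h₀ n).continuous
        (hd.sq_enorm_fourier_comp_sub_le (by linarith) h₀ n)⟩
  have hsucc : ∀ s, 0 ≤ s → s ≤ q - 1 → P s → P (s + 1) := by
    rintro s hs hsq ⟨C, hC, h⟩
    -- The factor of `v - v₀` lies in `H^s` because composition with `φ₀` is bounded there.
    have hA : energy s (fourierCoeff fun x => (fourier n (φ₀ x) : ℂ)) ≠ ⊤ := by
      obtain ⟨m, M, hm, hmM⟩ :=
        exists_pos_forall_le_of_continuous h₀.hasLiftDeriv.continuous_deriv h₀.pos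
      obtain ⟨D, hD, hDb⟩ := exists_compBound hm M (q - 1)
        (ENNReal.mul_ne_top (mulConst_ne_top (s := q - 1) hr) h₀.energy_deriv_ne_top) hs
        (by linarith)
      exact ne_top_of_le_ne_top (ENNReal.mul_ne_top hD (energy_fourierCoeff_fourier_ne_top s n))
        (hDb φ₀ v₀ h₀.hasLiftDeriv (fun x => (hmM x).1) (fun x => (hmM x).2)
          (h₀.hasLiftDeriv.compMulBound le_rfl) _ (memLp_of_continuous
            (isDeriv_fourier n).continuous 2))
    set A := energy s (fourierCoeff fun x => (fourier n (φ₀ x) : ℂ)) with hAdef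
    set κ := mulConst s (q - 1) with hκ
    have hκt : κ ≠ ⊤ := mulConst_ne_top hr
    refine ⟨C + ‖c‖ₑ ^ 2 * (2 * (κ * C * B + κ * A * derivConst)),
      by have := derivConst_ne_top; finiteness, fun φ g d v w hd hg => ?_⟩
    have hD := hd.isDeriv_fourier_comp_sub h₀ n
    have hDs := h φ g d v w hd hg
    refine (hD.energy_succ_le s).trans ?_
    rw [add_mul]
    refine add_le_add hDs ?_
    rw [← hc, fourierCoeff_const_mul, energy_const_mul, mul_assoc]
    gcongr
    have c1 : Continuous fun x => (v x : ℂ) :=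
      Complex.continuous_ofReal.comp hd.hasLiftDeriv.continuous_deriv
    have c2 : Continuous fun x => (fourier n (φ₀ x) : ℂ) :=
      (isDeriv_fourier n).continuous.comp h₀.hasLiftDeriv.continuous
    have c3 := (hd.isDeriv_sub h₀).1
    refine (energy_fourierCoeff_add_le s (hD.continuous.mul c1) (c2.mul c3)).trans ?_
    rw [mul_assoc]
    refine mul_le_mul_right ?_ 2
    rw [add_mul]
    gcongr ?_ + ?_
    · refine (energy_mul_le hs hsq hD.continuous c1).trans ?_
      calc _ ≤ κ * (C * ENNReal.ofReal (‖g - g₀‖ ^ 2)) * B := by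
            gcongr
            exact (hb φ g d v w hd hg).2.2.1
        _ = _ := by ring
    · refine (energy_mul_le hs hsq c2 c3).trans ?_
      rw [mul_assoc (κ * A)]
      gcongr
      exact hd.energy_deriv_sub_le h₀
  have hall : ∀ (N : ℕ) (s : ℝ), 0 ≤ s → s ≤ q → s ≤ N → P s := by
    intro N
    induction N with
    | zero =>
      intro s hs _ hs0
      exact hmono s 0 (by simpa using hs0) hzero
    | succ N ih =>
      intro s hs hsq hsN
      push_cast at hsN
      rcases le_total s 1 with h1 | h1
      · exact hmono s (0 + 1) (by linarith) (hsucc 0 le_rfl (by linarith) hzero)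
      · have := hsucc (s - 1) (by linarith) (by linarith)
          (ih (s - 1) (by linarith) (by linarith) (by linarith))
        rwa [sub_add_cancel] at this
  obtain ⟨N, hN⟩ := exists_nat_ge s
  obtain ⟨C, hC, h⟩ := hall N s hs hsq hN
  refine ⟨δ, C, hδ, hC, fun φ g hφ hg => ?_⟩
  obtain ⟨d, v, w, hd⟩ := hφ.exists_isLiftData hq
  exact h φ g d v w hd hg

end Local

/-! ### Displacements modulo integers and the quotient topology -/

theorem mem_submodule_of_energy {𝕜 : Type*} [RCLike 𝕜] {s : ℝ} {u : L2 𝕜}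
    (h : energy s (coeff u) ≠ ⊤) : u ∈ submodule 𝕜 s := by
  change Summable _
  refine (ENNReal.summable_toReal h).congr fun k => ?_
  rw [wt_rpow_eq_ofReal, enorm_sq_eq_ofReal, ENNReal.toReal_mul,
    ENNReal.toReal_ofReal (by positivity), ENNReal.toReal_ofReal (by positivity)]

theorem exists_space_const (q c : ℝ) : ∃ g : Space ℝ q,
    (g : UnitAddCircle → ℝ) =ᵐ[AddCircle.haarAddCircle] fun _ => c := by
  have h1 := Lp.coeFn_const (p := 2) (μ := (AddCircle.haarAddCircle : Measure UnitAddCircle)) c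
  have h2 : energy q (coeff (Lp.const 2 AddCircle.haarAddCircle c : L2 ℝ)) ≠ ⊤ := by
    rw [coeff_eq_of_ae h1]
    have := fourierCoeff_const_mul (RCLike.map ℝ ℂ c) fun _ => 1
    simp only [mul_one] at this
    simp only [Function.const_apply]
    rw [this, energy_const_mul]
    exact ENNReal.mul_ne_top (by finiteness) (energy_fourierCoeff_one_ne_top q)
  exact ⟨⟨_, mem_submodule_of_energy h2⟩, h1⟩

theorem Space.coeFn_add {q : ℝ} (g g' : Space ℝ q) :
    ((g + g' : Space ℝ q) : UnitAddCircle → ℝ) =ᵐ[AddCircle.haarAddCircle] fun x => g x + g' x :=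
  Lp.coeFn_add g.toL2 g'.toL2

theorem IsDisplacement.add_int {q : ℝ} {φ : UnitAddCircle → UnitAddCircle} {g g' : Space ℝ q}
    (h : IsDisplacement φ g) (n : ℤ)
    (hn : (g' : UnitAddCircle → ℝ) =ᵐ[AddCircle.haarAddCircle] fun _ => (n : ℝ)) :
    IsDisplacement φ (g + g') := by
  obtain ⟨d, hφ, hmono, hC, hg⟩ := h
  have hX : (fun x : ℝ => x + (d (x : UnitAddCircle) + (n : ℝ))) =
      fun x : ℝ => (x + d (x : UnitAddCircle)) + (n : ℝ) := by
    ext x; ring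
  refine ⟨d + ContinuousMap.const _ (n : ℝ), fun x => ?_, ?_, ?_, ?_⟩
  · simp [hφ x]
  · simp only [ContinuousMap.add_apply, ContinuousMap.const_apply]
    rw [hX]
    exact hmono.add_const _
  · simp only [ContinuousMap.add_apply, ContinuousMap.const_apply]
    rw [hX]
    exact hC.add contDiff_const
  · filter_upwards [Space.coeFn_add g g', hg, hn] with x h1 h2 h3
    rw [h1, h2, h3]
    rfl

/-- Two displacements of the same circle map differ by an integer constant. -/
theorem IsDisplacement.exists_int {q : ℝ} {φ : UnitAddCircle → UnitAddCircle} {g₁ g₂ : Space ℝ q}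
    (h₁ : IsDisplacement φ g₁) (h₂ : IsDisplacement φ g₂) : ∃ n : ℤ, ∀ g' : Space ℝ q,
      (g' : UnitAddCircle → ℝ) =ᵐ[AddCircle.haarAddCircle] (fun _ => (n : ℝ)) → g₂ = g₁ + g' := by
  obtain ⟨d₁, v₁, hφ₁, hg₁, hL₁, hD₁, -⟩ := h₁.exists_deriv
  obtain ⟨d₂, v₂, hφ₂, hg₂, hL₂, hD₂, -⟩ := h₂.exists_deriv
  -- Both lifts have the same derivative, so `d₂ - d₁` is constant; evaluating at `0` shows that the
  -- constant is an integer.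
  have hv : v₁ = v₂ := by
    ext x
    have h := congrFun (((isDeriv_fourier 1).comp hL₁).unique ((isDeriv_fourier 1).comp hL₂)) x
    have h4 : (2 * Real.pi * Complex.I * (1 : ℤ) * fourier 1 (φ x) : ℂ) ≠ 0 :=
      mul_ne_zero (by simp [Real.pi_ne_zero]) (fourier_ne_zero 1 _)
    exact_mod_cast mul_left_cancel₀ h4 h
  have hsub := hD₂.sub hD₁
  have hconst : ∀ x, d₂ x - d₁ x = d₂ 0 - d₁ 0 := by
    intro x
    obtain ⟨t, rfl⟩ := QuotientAddGroup.mk_surjective x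
    have h := is_const_of_deriv_eq_zero (𝕜 := ℝ) (fun y => (hsub.2 y).differentiableAt)
      (fun y => by rw [(hsub.2 y).deriv, hv]; simp) t 0
    simp only [Pi.sub_apply, ← Complex.ofReal_sub] at h
    exact_mod_cast h
  have h0 : ((d₂ 0 : ℝ) : UnitAddCircle) = ((d₁ 0 : ℝ) : UnitAddCircle) := by
    have := (hφ₂ 0).symm.trans (hφ₁ 0)
    simpa using this
  obtain ⟨n, hn⟩ : ∃ n : ℤ, d₂ 0 - d₁ 0 = n := by
    rw [← sub_eq_zero, ← AddCircle.coe_sub, AddCircle.coe_eq_zero_iff] at h0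
    obtain ⟨n, hn⟩ := h0
    exact ⟨n, by rw [← hn]; simp⟩
  refine ⟨n, fun g' hg' => Subtype.ext (Lp.ext ?_)⟩
  change (g₂ : UnitAddCircle → ℝ) =ᵐ[_] ((g₁ + g' : Space ℝ q) : UnitAddCircle → ℝ)
  filter_upwards [hg₁, hg₂, hg', Space.coeFn_add g₁ g'] with x e1 e2 e3 e4
  rw [e4, e1, e2, e3, ← hn, ← hconst x]
  ring

/-- The diffeomorphisms that have a displacement near `g₀` form a neighbourhood of `φ₀`. -/
theorem setOf_exists_displacement_mem_nhds {q : ℝ} {φ₀ : Diffeo q} {g₀ : Space ℝ q}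
    (h₀ : IsDisplacement φ₀ g₀) {ε : ℝ} (hε : 0 < ε) :
    {φ : Diffeo q | ∃ g : Space ℝ q, IsDisplacement φ g ∧ ‖g - g₀‖ < ε} ∈ 𝓝 φ₀ := by
  refine IsOpen.mem_nhds ?_ ⟨g₀, h₀, by simpa using hε⟩
  rw [isOpen_coinduced]
  have hcont : Continuous fun p : Diffeo.Lift q => p.1.2 := continuous_induced_dom
  rw [isOpen_iff_mem_nhds]
  rintro p ⟨g, hg, hgε⟩
  -- The displacement carried by `p` need not be near `g₀`, but an integer translate of it is. The
  -- same translation moves all lifts close to `p` into the ball, so the preimage is open.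
  obtain ⟨n, hn⟩ := p.2.exists_int hg
  obtain ⟨g', hg'⟩ := exists_space_const q n
  have hgp := hn g' hg'
  have hopen : IsOpen {p' : Diffeo.Lift q | ‖p'.1.2 + g' - g₀‖ < ε} :=
    isOpen_lt ((hcont.add continuous_const).sub continuous_const).norm continuous_const
  refine mem_of_superset (hopen.mem_nhds (x := p) ?_) fun p' hp' =>
    ⟨p'.1.2 + g', p'.2.add_int n hg', hp'⟩
  change ‖p.1.2 + g' - g₀‖ < ε
  rwa [← hgp]

/-! ### The composition operator on Sobolev classes -/

theorem memLp_map {𝕜 : Type*} [RCLike 𝕜] (u : L2 𝕜) :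
    MemLp (fun x => RCLike.map 𝕜 ℂ (u x)) 2 AddCircle.haarAddCircle :=
  (Lp.memLp ((RCLike.map 𝕜 ℂ).compLp u)).ae_eq ((RCLike.map 𝕜 ℂ).coeFn_compLp u)

theorem Diffeo.exists_isLiftData {q : ℝ} (hq : 3 / 2 < q) (φ : Diffeo q) :
    ∃ g d v w, IsDisplacement φ g ∧ IsLiftData φ g d v w := by
  obtain ⟨g, hg⟩ := φ.exists_displacement
  obtain ⟨d, v, w, h⟩ := IsDisplacement.exists_isLiftData hq hg
  exact ⟨g, d, v, w, hg, h⟩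

theorem Diffeo.quasiMeasurePreserving {q : ℝ} (hq : 3 / 2 < q) (φ : Diffeo q) :
    Measure.QuasiMeasurePreserving φ AddCircle.haarAddCircle AddCircle.haarAddCircle := by
  obtain ⟨g, d, v, w, -, h⟩ := φ.exists_isLiftData hq
  obtain ⟨m, M, hm, hmM⟩ :=
    exists_pos_forall_le_of_continuous h.hasLiftDeriv.continuous_deriv h.pos
  exact h.hasLiftDeriv.quasiMeasurePreserving hm fun x => (hmM x).1

theorem Diffeo.memLp_comp {q : ℝ} (hq : 3 / 2 < q) (φ : Diffeo q) {E : Type*}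
    [NormedAddCommGroup E] {f : UnitAddCircle → E} (hf : MemLp f 2 AddCircle.haarAddCircle) :
    MemLp (f ∘ φ) 2 AddCircle.haarAddCircle := by
  obtain ⟨g, d, v, w, -, h⟩ := φ.exists_isLiftData hq
  obtain ⟨m, M, hm, hmM⟩ :=
    exists_pos_forall_le_of_continuous h.hasLiftDeriv.continuous_deriv h.pos
  exact h.hasLiftDeriv.memLp_comp hm (fun x => (hmM x).1) hf

section Operator

variable {𝕜 : Type*} [RCLike 𝕜] {ρ q : ℝ}

theorem norm_le_sqrt_mul_of_energy_le {u u' : Space 𝕜 ρ} {C : ℝ≥0∞} (hC : C ≠ ⊤)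
    (h : energy ρ (coeff u'.toL2) ≤ C * energy ρ (coeff u.toL2)) :
    ‖u'‖ ≤ Real.sqrt C.toReal * ‖u‖ := by
  rw [energy_coeff, energy_coeff, ← ENNReal.ofReal_toReal hC,
    ← ENNReal.ofReal_mul ENNReal.toReal_nonneg, ENNReal.ofReal_le_ofReal_iff (by positivity)] at h
  refine (pow_le_pow_iff_left₀ (norm_nonneg _) (by positivity) two_ne_zero).1 ?_
  rwa [mul_pow, Real.sq_sqrt ENNReal.toReal_nonneg]

theorem energy_coeff_le_of_compBound {φ : UnitAddCircle → UnitAddCircle} {C : ℝ≥0∞}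
    (hC : CompBound φ ρ C) {u u' : L2 𝕜} (h : u' =ᵐ[AddCircle.haarAddCircle] u ∘ φ) :
    energy ρ (coeff u') ≤ C * energy ρ (coeff u) := by
  rw [coeff_eq_of_ae h, coeff_eq_of_ae (u := u) EventuallyEq.rfl]
  exact hC (fun x => RCLike.map 𝕜 ℂ (u x)) (memLp_map u)

/-- The composition operator `R_φ`. -/
theorem Diffeo.exists_compCLM (hρ : 0 ≤ ρ) (hq : 3 / 2 < q) (hρq : ρ ≤ q) (φ : Diffeo q) :
    ∃ T : Space 𝕜 ρ →L[𝕜] Space 𝕜 ρ, ∀ u : Space 𝕜 ρ,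
      (T u : UnitAddCircle → 𝕜) =ᵐ[AddCircle.haarAddCircle] u ∘ φ := by
  obtain ⟨g, d, v, w, hg, h⟩ := φ.exists_isLiftData hq
  obtain ⟨δ, C, hδ, hC, hb⟩ := h.exists_local_compBound hq hρ hρq
  have hCb := (hb φ g hg (by simpa using hδ)).1
  have hqm := φ.quasiMeasurePreserving hq
  let S : Space 𝕜 ρ → L2 𝕜 := fun u => (φ.memLp_comp hq (Lp.memLp u.toL2)).toLp
  have hS : ∀ u, (S u : UnitAddCircle → 𝕜) =ᵐ[AddCircle.haarAddCircle] u ∘ φ := fun u =>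
    MemLp.coeFn_toLp _
  have hmem : ∀ u, S u ∈ submodule 𝕜 ρ := fun u => by
    refine mem_submodule_of_energy (ne_top_of_le_ne_top ?_
      (energy_coeff_le_of_compBound hCb (hS u)))
    rw [energy_coeff]
    finiteness
  let T : Space 𝕜 ρ →ₗ[𝕜] Space 𝕜 ρ :=
    { toFun := fun u => ⟨S u, hmem u⟩
      map_add' := fun u u' => by
        refine Subtype.ext (Lp.ext ?_)
        change (S (u + u') : UnitAddCircle → 𝕜) =ᵐ[_] ((S u + S u' : L2 𝕜) : UnitAddCircle → 𝕜)
        have h1 : (((u + u' : Space 𝕜 ρ) : UnitAddCircle → 𝕜)) =ᵐ[AddCircle.haarAddCircle]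
            fun x => u x + u' x := Lp.coeFn_add u.toL2 u'.toL2
        filter_upwards [hS (u + u'), hS u, hS u', Lp.coeFn_add (S u) (S u'), hqm.ae h1]
          with x e1 e2 e3 e4 e5
        rw [e1, e4, Pi.add_apply, e2, e3, Function.comp_apply, e5]
        rfl
      map_smul' := fun c u => by
        refine Subtype.ext (Lp.ext ?_)
        change (S (c • u) : UnitAddCircle → 𝕜) =ᵐ[_] ((c • S u : L2 𝕜) : UnitAddCircle → 𝕜)
        have h1 : (((c • u : Space 𝕜 ρ) : UnitAddCircle → 𝕜)) =ᵐ[AddCircle.haarAddCircle]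
            fun x => c • u x := Lp.coeFn_smul c u.toL2
        filter_upwards [hS (c • u), hS u, Lp.coeFn_smul c (S u), hqm.ae h1] with x e1 e2 e3 e4
        rw [e1, e3, Pi.smul_apply, e2, Function.comp_apply, e4]
        rfl }
  exact ⟨T.mkContinuous (Real.sqrt C.toReal) fun u =>
    norm_le_sqrt_mul_of_energy_le hC (energy_coeff_le_of_compBound hCb (hS u)), hS⟩

theorem norm_le_of_compBound {φ : UnitAddCircle → UnitAddCircle} {T : Space 𝕜 ρ →L[𝕜] Space 𝕜 ρ}
    (hT : ∀ u : Space 𝕜 ρ, (T u : UnitAddCircle → 𝕜) =ᵐ[AddCircle.haarAddCircle] u ∘ φ)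
    {C : ℝ≥0∞} (hC : C ≠ ⊤) (hCb : CompBound φ ρ C) : ‖T‖ ≤ Real.sqrt C.toReal :=
  T.opNorm_le_bound (Real.sqrt_nonneg _) fun u =>
    norm_le_sqrt_mul_of_energy_le hC (energy_coeff_le_of_compBound hCb (hT u))

end Operator

/-! ### Continuity in the diffeomorphism -/

section Continuity

variable {q : ℝ}

theorem Diffeo.continuous {q : ℝ} (φ : Diffeo q) : Continuous φ := φ.toHomeomorph.continuous

theorem Diffeo.eventually_compBound (hq : 3 / 2 < q) (φ₀ : Diffeo q) {s : ℝ} (hs : 0 ≤ s)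
    (hsq : s ≤ q) : ∃ C : ℝ≥0∞, C ≠ ⊤ ∧ ∀ᶠ φ in 𝓝 φ₀, CompBound (φ : Diffeo q) s C ∧
      CompBound (φ⁻¹ : Diffeo q) s C := by
  obtain ⟨g₀, d₀, v₀, w₀, hg₀, h₀⟩ := φ₀.exists_isLiftData hq
  obtain ⟨δ, C, hδ, hC, hb⟩ := h₀.exists_local_compBound hq hs hsq
  refine ⟨C, hC, ?_⟩
  filter_upwards [setOf_exists_displacement_mem_nhds hg₀ hδ] with φ hφ
  obtain ⟨g, hg, hgδ⟩ := hφ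
  exact hb φ g hg hgδ

theorem Diffeo.tendsto_energy_fourier_comp (hq : 3 / 2 < q) (φ₀ : Diffeo q) {s : ℝ} (hs : 0 ≤ s)
    (hsq : s ≤ q) (n : ℤ) :
    Tendsto (fun φ : Diffeo q => energy s (fourierCoeff fun x =>
      (fourier n (φ x) : ℂ) - fourier n (φ₀ x))) (𝓝 φ₀) (𝓝 0) := by
  obtain ⟨g₀, d₀, v₀, w₀, hg₀, h₀⟩ := φ₀.exists_isLiftData hq
  obtain ⟨δ, C, hδ, hC, hb⟩ := h₀.exists_energy_fourier_comp_sub_le hq n hs hsq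
  rw [ENNReal.tendsto_nhds_zero]
  intro ε hε
  obtain ⟨δ', hδ', hb'⟩ := exists_pos_mul_sq_le hC hε.ne'
  filter_upwards [setOf_exists_displacement_mem_nhds hg₀ (lt_min hδ hδ')] with φ hφ
  obtain ⟨g, hg, hgδ⟩ := hφ
  exact (hb φ g hg (hgδ.trans_le (min_le_left _ _))).trans
    (hb' _ (norm_nonneg _) (hgδ.trans_le (min_le_right _ _)))

theorem Diffeo.tendsto_energy_trig_comp (hq : 3 / 2 < q) (φ₀ : Diffeo q) {s : ℝ} (hs : 0 ≤ s)
    (hsq : s ≤ q) (F : Finset ℤ) (c : ℤ → ℂ) :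
    Tendsto (fun φ : Diffeo q => energy s (fourierCoeff (trig F c ∘ φ - trig F c ∘ φ₀)))
      (𝓝 φ₀) (𝓝 0) := by
  induction F using Finset.induction_on with
  | empty =>
    have h : ∀ φ : Diffeo q, trig ∅ c ∘ φ - trig ∅ c ∘ φ₀ = fun _ => (0 : ℂ) * 1 := fun φ => by
      ext x; simp [trig]
    simp only [h, fourierCoeff_const_mul, energy_const_mul]
    simp
  | insert k F hk ih =>
    have h1 : ∀ φ : Diffeo q, trig (insert k F) c ∘ φ - trig (insert k F) c ∘ φ₀ =
        (fun x => c k * ((fourier k (φ x) : ℂ) - fourier k (φ₀ x))) +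
          (trig F c ∘ φ - trig F c ∘ φ₀) := fun φ => by
      ext x
      simp only [trig, Function.comp_apply, Pi.sub_apply, Pi.add_apply, Finset.sum_insert hk]
      ring
    have h2 := (ENNReal.Tendsto.const_mul (φ₀.tendsto_energy_fourier_comp hq hs hsq k)
      (a := ‖c k‖ₑ ^ 2) (Or.inr (by finiteness))).add ih
    have h3 := ENNReal.Tendsto.const_mul h2 (a := 2) (Or.inr (by norm_num))
    simp only [mul_zero, add_zero] at h3
    refine tendsto_of_tendsto_of_tendsto_of_le_of_le tendsto_const_nhds h3 (fun _ => zero_le)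
      fun φ => ?_
    have hcont : Continuous fun x => c k * ((fourier k (φ x) : ℂ) - fourier k (φ₀ x)) :=
      continuous_const.mul (((map_continuous (fourier k)).comp φ.continuous).sub
        ((map_continuous (fourier k)).comp φ₀.continuous))
    simp only [h1]
    refine (energy_fourierCoeff_add_le s hcont
      (((continuous_trig F c).comp φ.continuous).sub
        ((continuous_trig F c).comp φ₀.continuous))).trans ?_
    rw [fourierCoeff_const_mul, energy_const_mul]

theorem energy_fourierCoeff_sub_le (s : ℝ) {f g : UnitAddCircle → ℂ}
    (hf : MemLp f 2 AddCircle.haarAddCircle) (hg : MemLp g 2 AddCircle.haarAddCircle) :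
    energy s (fourierCoeff (f - g)) ≤
      2 * (energy s (fourierCoeff f) + energy s (fourierCoeff g)) := by
  rw [fourierCoeff_sub hf hg, sub_eq_add_neg, ← energy_neg s (fourierCoeff g)]
  exact energy_add_le s _ _

/-- For `f ∈ H^s` the map `φ ↦ f ∘ φ` is continuous. -/
theorem Diffeo.tendsto_energy_comp (hq : 3 / 2 < q) (φ₀ : Diffeo q) {s : ℝ} (hs : 0 ≤ s)
    (hsq : s ≤ q) {f : UnitAddCircle → ℂ} (hf : MemLp f 2 AddCircle.haarAddCircle)
    (hfs : energy s (fourierCoeff f) ≠ ⊤) :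
    Tendsto (fun φ : Diffeo q => energy s (fourierCoeff (f ∘ φ - f ∘ φ₀))) (𝓝 φ₀) (𝓝 0) := by
  obtain ⟨C, hC, hCb⟩ := φ₀.eventually_compBound hq hs hsq
  rw [ENNReal.tendsto_nhds_zero]
  intro ε hε
  have ht := ENNReal.Tendsto.const_mul (tendsto_energy_sub_trig hf hfs) (a := 2 * (C + C))
    (Or.inr (by finiteness))
  rw [mul_zero] at ht
  have hε4 : (0 : ℝ≥0∞) < ε / 4 := ENNReal.div_pos hε.ne' (by norm_num)
  obtain ⟨F, hF⟩ := (ENNReal.tendsto_nhds_zero.1 ht _ hε4).exists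
  set p := trig F (fourierCoeff f) with hp
  have hpm : MemLp p 2 AddCircle.haarAddCircle := memLp_of_continuous (continuous_trig _ _) 2
  filter_upwards [ENNReal.tendsto_nhds_zero.1
    (φ₀.tendsto_energy_trig_comp hq hs hsq F (fourierCoeff f)) _ hε4, hCb] with φ h1 h2
  -- The bound also holds at `φ₀` itself, so the tail `f - p` is controlled under both compositions.
  have h3 := hCb.self_of_nhds
  have hsplit : f ∘ φ - f ∘ φ₀ = ((f - p) ∘ φ - (f - p) ∘ φ₀) - (p ∘ φ₀ - p ∘ φ) := by
    ext x
    simp only [Pi.sub_apply, Function.comp_apply]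
    ring
  have hm := fun ψ : Diffeo q => ψ.memLp_comp hq (hf.sub hpm)
  have hm' := fun ψ : Diffeo q => ψ.memLp_comp hq hpm
  have hswap : energy s (fourierCoeff (p ∘ φ₀ - p ∘ φ)) =
      energy s (fourierCoeff (p ∘ φ - p ∘ φ₀)) := by
    rw [fourierCoeff_sub (hm' _) (hm' _), fourierCoeff_sub (hm' _) (hm' _), ← energy_neg, neg_sub]
  rw [hsplit]
  calc _ ≤ 2 * (energy s (fourierCoeff ((f - p) ∘ φ - (f - p) ∘ φ₀)) +
        energy s (fourierCoeff (p ∘ φ₀ - p ∘ φ))) :=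
        energy_fourierCoeff_sub_le s ((hm φ).sub (hm φ₀)) ((hm' φ₀).sub (hm' φ))
    _ ≤ 2 * (2 * (C * energy s (fourierCoeff (f - p)) + C * energy s (fourierCoeff (f - p))) +
        ε / 4) := by
        rw [hswap]
        gcongr
        refine (energy_fourierCoeff_sub_le s (hm φ) (hm φ₀)).trans ?_
        gcongr
        · exact h2.1 _ (hf.sub hpm)
        · exact h3.1 _ (hf.sub hpm)
    _ = 2 * (2 * (C + C) * energy s (fourierCoeff (f - p)) + ε / 4) := by ring
    _ ≤ 2 * (ε / 4 + ε / 4) := by gcongr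
    _ = ε := by
        rw [← two_mul, ← mul_assoc]
        norm_num
        exact ENNReal.mul_div_cancel (by norm_num) (by norm_num)

end Continuity

end CircleSobolev

open CircleSobolev in
theorem mainTheorem11 (𝕜 : Type*) [RCLike 𝕜] (ρ q : ℝ) (hρ : 3 / 2 < ρ) (hρq : ρ ≤ q) :
    ∃ R : CircleSobolev.Diffeo q →
        (CircleSobolev.Space 𝕜 ρ →L[𝕜] CircleSobolev.Space 𝕜 ρ),
      (∀ (φ : CircleSobolev.Diffeo q) (u : CircleSobolev.Space 𝕜 ρ) (f : UnitAddCircle → 𝕜),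
        u =ᵐ[AddCircle.haarAddCircle] f → R φ u =ᵐ[AddCircle.haarAddCircle] f ∘ φ) ∧
      Continuous (fun p : CircleSobolev.Diffeo q × CircleSobolev.Space 𝕜 ρ => R p.1 p.2) ∧
      CircleSobolev.LocallyBounded R ∧
      CircleSobolev.LocallyBounded (fun φ : CircleSobolev.Diffeo q => R φ⁻¹) := by
  have hρ0 : 0 ≤ ρ := by linarith
  have hq : 3 / 2 < q := hρ.trans_le hρq
  choose R hR using fun φ : Diffeo q => φ.exists_compCLM (𝕜 := 𝕜) hρ0 hq hρq
  refine ⟨R, fun φ u f hf => (hR φ u).trans ((φ.quasiMeasurePreserving hq).ae_eq hf), ?_,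
    fun φ₀ => ?_, fun φ₀ => ?_⟩
  · rw [continuous_iff_continuousAt]
    rintro ⟨φ₀, u₀⟩
    obtain ⟨C, hC, hCb⟩ := φ₀.eventually_compBound hq hρ0 hρq
    have hstrong : Tendsto (fun φ : Diffeo q => ‖R φ u₀ - R φ₀ u₀‖) (𝓝 φ₀) (𝓝 0) := by
      have hfin : energy ρ (coeff u₀.toL2) ≠ ⊤ := by
        rw [energy_coeff]
        finiteness
      have h1 := φ₀.tendsto_energy_comp hq hρ0 hρq (memLp_map u₀.toL2) hfin
      have h2 : ∀ φ : Diffeo q, ENNReal.ofReal (‖R φ u₀ - R φ₀ u₀‖ ^ 2) =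
          energy ρ (fourierCoeff ((fun x => RCLike.map 𝕜 ℂ (u₀ x)) ∘ φ -
            (fun x => RCLike.map 𝕜 ℂ (u₀ x)) ∘ φ₀)) := by
        intro φ
        have hae : ((R φ u₀ - R φ₀ u₀ : Space 𝕜 ρ) : UnitAddCircle → 𝕜)
            =ᵐ[AddCircle.haarAddCircle] fun x => u₀ (φ x) - u₀ (φ₀ x) := by
          have h3 : (R φ u₀ - R φ₀ u₀).toL2 = (R φ u₀).toL2 - (R φ₀ u₀).toL2 := rfl
          rw [h3]
          filter_upwards [Lp.coeFn_sub (R φ u₀).toL2 (R φ₀ u₀).toL2, hR φ u₀, hR φ₀ u₀]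
            with x e1 e2 e3
          rw [e1, Pi.sub_apply, e2, e3]
          rfl
        rw [← energy_coeff, coeff_eq_of_ae hae]
        simp only [map_sub]
        rfl
      simp_rw [← h2] at h1
      have h4 := (ENNReal.tendsto_toReal ENNReal.zero_ne_top).comp h1
      simp only [Function.comp_def, ENNReal.toReal_ofReal (sq_nonneg _), ENNReal.toReal_zero] at h4
      have h5 := (Real.continuous_sqrt.tendsto 0).comp h4
      simpa [Function.comp_def, Real.sqrt_sq (norm_nonneg _)] using h5
    rw [ContinuousAt, tendsto_iff_norm_sub_tendsto_zero, nhds_prod_eq]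
    have hu : Tendsto (fun u : Space 𝕜 ρ => Real.sqrt C.toReal * ‖u - u₀‖) (𝓝 u₀) (𝓝 0) := by
      have : Continuous fun u : Space 𝕜 ρ => Real.sqrt C.toReal * ‖u - u₀‖ := by fun_prop
      simpa using this.tendsto u₀
    have hsum := (hu.comp tendsto_snd).add (hstrong.comp (tendsto_fst (g := 𝓝 u₀)))
    rw [add_zero] at hsum
    refine squeeze_zero' (Eventually.of_forall fun _ => norm_nonneg _) ?_ hsum
    filter_upwards [tendsto_fst.eventually hCb] with p hp
    -- Strong continuity at `u₀` together with a locally uniform operator bound gives joint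
    -- continuity; continuity of `φ ↦ R φ` in operator norm is not needed.
    calc ‖R p.1 p.2 - R φ₀ u₀‖ = ‖R p.1 (p.2 - u₀) + (R p.1 u₀ - R φ₀ u₀)‖ := by
          rw [map_sub]; congr 1; abel
      _ ≤ ‖R p.1 (p.2 - u₀)‖ + ‖R p.1 u₀ - R φ₀ u₀‖ := norm_add_le _ _
      _ ≤ _ := by
          gcongr
          · exact (R p.1).le_of_opNorm_le (norm_le_of_compBound (hR p.1) hC hp.1) _
          · rfl
  · obtain ⟨C, hC, hCb⟩ := φ₀.eventually_compBound hq hρ0 hρq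
    exact ⟨_, hCb, Real.sqrt C.toReal, fun φ hφ => norm_le_of_compBound (hR φ) hC hφ.1⟩
  · obtain ⟨C, hC, hCb⟩ := φ₀.eventually_compBound hq hρ0 hρq
    exact ⟨_, hCb, Real.sqrt C.toReal, fun φ hφ => norm_le_of_compBound (hR φ⁻¹) hC hφ.2⟩
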